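/- Let $k\in\mathbb Z$ and let $\mu$ be a probability distribution on $\mathbb Z$ with $\mu(\{l\})=0$ for all $l>k$, $\mu(\{k\})\,\mu(\{k-1\})>0$ and $\sum_{l\in\mathbb Z}|l|\,\mu(\{l\})<\infty$. Put $q_k=1-\mu(\{k\})$. For every $N\ge 1$ let $\{\xi_{i,j}(s):1\le i,j\le N,\ s\ge 1\}$ be i.i.d. random variables with law $\mu$, and consider the system of $N$ particles on the real line which, from an initial configuration $X(0)\in\mathbb R^N$, evolves by $$X_i(t+1)=\max_{1\le j\le N}\{X_j(t)+\xi_{i,j}(t+1)\},\qquad 1\le i\le N,\ t\ge 0.$$ Then for every $N\ge1$ the speed of the front $$v_N=\lim_{t\to\infty}t^{-1}\max_{1\le i\le N}X_i(t)=\lim_{t\to\infty}t^{-1}\min_{1\le i\le N}X_i(t)$$ exists almost surely as a deterministic real constant that does not depend on the initial configuration (almost surely, both limits exist and equal $v_N$ for all $X(0)\in\mathbb R^N$ simultaneously), and $$v_N=k-q_k^{N^2}2^N+o\big(q_k^{N^2}2^N\big)\qquad\text{as }N\to\infty.$$ -/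

import Mathlib

open MeasureTheory ProbabilityTheory Filter Topology Asymptotics

/-- One realisation of the `N`-particle system on the real line, started from `x₀` and driven by
the array `w`, where `w t i j` is the jump `ξ_{i,j}(t+1)` used in the step from time `t` to `t+1`:
`X_i(0) = x₀ i` and `X_i(t+1) = max_j (X_j(t) + ξ_{i,j}(t+1))`.
For `N ≥ 1` the supremum below is a maximum over a finite nonempty set. -/
noncomputable def particlePosition {N : ℕ} (w : ℕ → Fin N → Fin N → ℤ) (x₀ : Fin N → ℝ) :
    ℕ → Fin N → ℝ
  | 0 => x₀
  | t + 1 => fun i => ⨆ j : Fin N, (particlePosition w x₀ t j + (w t i j : ℝ))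

/-- Under `P`, the integer variables `ξ t i j` (`t ∈ ℕ`, `1 ≤ i, j ≤ N`) are independent and
identically distributed with law `μ`. -/
structure IsIIDNoise {Ω : Type*} [MeasurableSpace Ω] (P : Measure Ω) {N : ℕ}
    (ξ : ℕ → Fin N → Fin N → Ω → ℤ) (μ : Measure ℤ) : Prop where
  hasLaw : ∀ t i j, HasLaw (ξ t i j) μ P
  indep : iIndepFun (fun a : ℕ × Fin N × Fin N => ξ a.1 a.2.1 a.2.2) P

/-- `v` is the speed of the front of the `N`-particle system driven by `ξ`: almost surely, from
every initial configuration, both `t⁻¹ max_i X_i(t)` and `t⁻¹ min_i X_i(t)` converge to `v` as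
`t → ∞`. The initial configuration is quantified inside the almost sure event, so that random
initial configurations are covered as well. -/
def IsFrontSpeed {Ω : Type*} [MeasurableSpace Ω] (P : Measure Ω) {N : ℕ}
    (ξ : ℕ → Fin N → Fin N → Ω → ℤ) (v : ℝ) : Prop :=
  ∀ᵐ ω ∂P, ∀ x₀ : Fin N → ℝ,
    Tendsto (fun t : ℕ =>
      (⨆ i : Fin N, particlePosition (fun s i j => ξ s i j ω) x₀ t i) / (t : ℝ)) atTop (𝓝 v) ∧
    Tendsto (fun t : ℕ =>
      (⨅ i : Fin N, particlePosition (fun s i j => ξ s i j ω) x₀ t i) / (t : ℝ)) atTop (𝓝 v)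

/-!
Put `c = k - ξ ≥ 0`, the loss of a jump with respect to the largest possible one, so that
`X_i(t) = k t - Y_i(t)` where the deficits `Y` solve `Y_i(t+1) = min_j (Y_j(t) + c_{ij}(t+1))`. With
`q = P(c > 0)`, the claim becomes that the leader's deficit grows at a rate `l_N ~ 2^N q^(N²)`.

*The rate exists.* Started from the flat configuration, the least deficit over a time interval is
superadditive under concatenation of intervals and the largest one is subadditive. The strong law
for the independent blocks of `n` steps therefore places the limit points of `min Y(t) / t` between
`E min Y(n) / n` and `E max Y(n) / n`. One step resets the spread, `max Y(n) ≤ min Y(n-1) + ∑ c(n)`,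
so these bounds differ by `O(1/n)` and `min Y(t) / t` converges (`exists_lossRate`), with
`n l_N = E min Y(n) + O(1)`. The order preserving, translation equivariant dynamics forgets the
initial configuration up to a bounded error (`tendsto_front_of_tendsto_minLoss`).

*The asymptotics.* Given `z` leaders, each particle independently keeps the leading position with
probability `1 - q^z`, so the next number of leaders is binomial and the front loses ground exactly
when it is zero, with probability `q^(zN)`. From a full front, passing through `z` leaders and then
losing has total weight about `∑ z, C(N,z) q^(N(N-z)) q^(zN) = 2^N q^(N²)`. To make this an exact
rate, add to `min Y` a bounded function `φ(z)` of the number of leaders and bound the one-step drift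
of the sum uniformly over all configurations; a drift `≤ K` (`≥ K`) gives `l_N ≤ K` (`≥ K`), by
`lossRate_le` and `le_lossRate`.

* Lower bound: `φ(z) = q^(zN)`. The expectation of `φ` after one step, counting a loss as `1`, is
  the binomial generating function `(q^z + (1 - q^z) q^N)^N`, estimated in `le_binomial_generating`.
* Upper bound: `φ(z)` is `q^(zN)` times a weight which is nearly `1` unless `N - z < √N`, where it
  is inflated to `4 (1 + q)^N`; this inflation absorbs the excursions close to a full front and remains
  invisible from the full front, where such states carry weight `2^(o(N))` only
  (`frontWeight_supersolution`). A loss larger than one requires that all `N` particles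
  miss a unit loss, which is exponentially unlikely given a loss because `P(c = 1) > 0`
  (`exists_excess_bound`).
-/

/-! ### Deficits along a fixed driving array -/

section Deterministic

variable {ι : Type*}

/-- One step of the min-plus system of losses: `y i` is the deficit of particle `i` with respect to
the fastest possible motion, and `c i j` is the loss on the jump from `j` to `i`. -/
noncomputable def lossStep (c : ι → ι → ℕ) (y : ι → ℕ) : ι → ℕ := fun i => ⨅ j, (y j + c i j)

/-- The trajectory of the deficits started from `y` and driven by the losses `c`. -/
noncomputable def lossPath (c : ℕ → ι → ι → ℕ) (y : ι → ℕ) : ℕ → ι → ℕ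
  | 0 => y
  | t + 1 => lossStep (c t) (lossPath c y t)

/-- The deficit of the leading particle at time `t`, started from the flat configuration. -/
noncomputable def minLoss (c : ℕ → ι → ι → ℕ) (t : ℕ) : ℕ := ⨅ i, lossPath c 0 t i

/-- The deficit of the last particle at time `t`, started from the flat configuration. -/
noncomputable def maxLoss (c : ℕ → ι → ι → ℕ) (t : ℕ) : ℕ := ⨆ i, lossPath c 0 t i

theorem lossStep_le (c : ι → ι → ℕ) (y : ι → ℕ) (i j : ι) : lossStep c y i ≤ y j + c i j :=
  ciInf_le' _ j

theorem le_lossStep_iff [Nonempty ι] {c : ι → ι → ℕ} {y : ι → ℕ} {i : ι} {a : ℕ} :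
    a ≤ lossStep c y i ↔ ∀ j, a ≤ y j + c i j :=
  le_ciInf_iff'

theorem lossStep_mono [Nonempty ι] (c : ι → ι → ℕ) {y y' : ι → ℕ} (h : y ≤ y') :
    lossStep c y ≤ lossStep c y' := fun i =>
  le_lossStep_iff.2 fun j => (lossStep_le c y i j).trans (Nat.add_le_add_right (h j) _)

theorem lossPath_mono [Nonempty ι] (c : ℕ → ι → ι → ℕ) {y y' : ι → ℕ} (h : y ≤ y') (t : ℕ) :
    lossPath c y t ≤ lossPath c y' t := by
  induction t with
  | zero => exact h
  | succ t ih => exact lossStep_mono _ ih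

theorem lossStep_add_const [Nonempty ι] (c : ι → ι → ℕ) (y : ι → ℕ) (a : ℕ) :
    lossStep c (fun i => y i + a) = fun i => lossStep c y i + a := by
  funext i
  obtain ⟨j, hj⟩ : ∃ j, y j + c i j = lossStep c y i := ciInf_mem _
  apply le_antisymm
  · have := lossStep_le c (fun i => y i + a) i j
    grind
  · refine le_lossStep_iff.2 fun j => ?_
    have := lossStep_le c y i j
    grind

theorem lossPath_add_const [Nonempty ι] (c : ℕ → ι → ι → ℕ) (y : ι → ℕ) (a : ℕ) (t : ℕ) :
    lossPath c (fun i => y i + a) t = fun i => lossPath c y t i + a := by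
  induction t with
  | zero => rfl
  | succ t ih => simp only [lossPath, ih, lossStep_add_const]

theorem lossPath_add (c : ℕ → ι → ι → ℕ) (y : ι → ℕ) (s t : ℕ) :
    lossPath c y (s + t) = lossPath (fun r => c (s + r)) (lossPath c y s) t := by
  induction t with
  | zero => rfl
  | succ t ih => rw [← add_assoc]; simp only [lossPath, ih]

theorem iInf_le_iInf_lossStep [Nonempty ι] (c : ι → ι → ℕ) (y : ι → ℕ) :
    ⨅ i, y i ≤ ⨅ i, lossStep c y i :=
  le_ciInf fun _ => le_lossStep_iff.2 fun j => (ciInf_le' y j).trans (Nat.le_add_right _ _)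

theorem lossStep_le_iInf_add_sum [Fintype ι] [Nonempty ι] (c : ι → ι → ℕ) (y : ι → ℕ) (i : ι) :
    lossStep c y i ≤ (⨅ i, y i) + ∑ i, ∑ j, c i j := by
  obtain ⟨j, hj⟩ : ∃ j, y j = ⨅ i, y i := ciInf_mem y
  have h1 : c i j ≤ ∑ j, c i j := Finset.single_le_sum (f := c i) (by simp) (Finset.mem_univ j)
  have h2 : ∑ j, c i j ≤ ∑ i, ∑ j, c i j :=
    Finset.single_le_sum (f := fun i => ∑ j, c i j) (by simp) (Finset.mem_univ i)
  have := lossStep_le c y i j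
  lia

theorem minLoss_monotone [Nonempty ι] (c : ℕ → ι → ι → ℕ) : Monotone (minLoss c) :=
  monotone_nat_of_le_succ fun t => iInf_le_iInf_lossStep (c t) (lossPath c 0 t)

theorem le_maxLoss [Fintype ι] (c : ℕ → ι → ι → ℕ) (t : ℕ) (i : ι) :
    lossPath c 0 t i ≤ maxLoss c t :=
  le_ciSup (f := lossPath c 0 t) (Set.finite_range _).bddAbove i

theorem minLoss_le (c : ℕ → ι → ι → ℕ) (t : ℕ) (i : ι) : minLoss c t ≤ lossPath c 0 t i :=
  ciInf_le' _ i

theorem minLoss_le_maxLoss [Fintype ι] [Nonempty ι] (c : ℕ → ι → ι → ℕ) (t : ℕ) :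
    minLoss c t ≤ maxLoss c t :=
  (minLoss_le c t (Classical.arbitrary ι)).trans (le_maxLoss c t _)

theorem maxLoss_succ_le [Fintype ι] [Nonempty ι] (c : ℕ → ι → ι → ℕ) (t : ℕ) :
    maxLoss c (t + 1) ≤ minLoss c t + ∑ i, ∑ j, c t i j :=
  ciSup_le fun i => lossStep_le_iInf_add_sum (c t) (lossPath c 0 t) i

theorem maxLoss_add_le [Fintype ι] [Nonempty ι] (c : ℕ → ι → ι → ℕ) (s t : ℕ) :
    maxLoss c (s + t) ≤ maxLoss c s + maxLoss (fun r => c (s + r)) t := by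
  refine ciSup_le fun i => ?_
  have h1 : lossPath c 0 s ≤ fun i => (0 : ι → ℕ) i + maxLoss c s := fun i => by
    simpa using le_maxLoss c s i
  have h2 := lossPath_mono (fun r => c (s + r)) h1 t i
  rw [lossPath_add_const] at h2
  rw [lossPath_add]
  have := le_maxLoss (fun r => c (s + r)) t i
  grind

theorem le_minLoss_add [Nonempty ι] (c : ℕ → ι → ι → ℕ) (s t : ℕ) :
    minLoss c s + minLoss (fun r => c (s + r)) t ≤ minLoss c (s + t) := by
  refine le_ciInf fun i => ?_
  have h1 : (fun i => (0 : ι → ℕ) i + minLoss c s) ≤ lossPath c 0 s := fun i => by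
    simpa using minLoss_le c s i
  have h2 := lossPath_mono (fun r => c (s + r)) h1 t i
  rw [lossPath_add_const] at h2
  rw [lossPath_add]
  have := minLoss_le (fun r => c (s + r)) t i
  grind

theorem sum_block_minLoss_le [Nonempty ι] (c : ℕ → ι → ι → ℕ) (n m : ℕ) :
    ∑ b ∈ Finset.range m, minLoss (fun r => c (n * b + r)) n ≤ minLoss c (n * m) := by
  induction m with
  | zero => simp
  | succ m ih =>
    rw [Finset.sum_range_succ, mul_add_one]
    exact (Nat.add_le_add_right ih _).trans (le_minLoss_add c _ _)

theorem maxLoss_le_sum_block [Fintype ι] [Nonempty ι] (c : ℕ → ι → ι → ℕ) (n m : ℕ) :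
    maxLoss c (n * m) ≤ ∑ b ∈ Finset.range m, maxLoss (fun r => c (n * b + r)) n := by
  induction m with
  | zero => simp [maxLoss, lossPath]
  | succ m ih =>
    rw [Finset.sum_range_succ, mul_add_one]
    exact (maxLoss_add_le c _ _).trans (Nat.add_le_add_right ih _)

theorem minLoss_le_sum [Fintype ι] [Nonempty ι] (c : ℕ → ι → ι → ℕ) (t : ℕ) :
    minLoss c t ≤ ∑ s ∈ Finset.range t, ∑ i, ∑ j, c s i j := by
  induction t with
  | zero => simp [minLoss, lossPath]
  | succ t ih =>
    rw [Finset.sum_range_succ]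
    exact (minLoss_le_maxLoss c _).trans ((maxLoss_succ_le c t).trans (Nat.add_le_add_right ih _))

end Deterministic

/-- Along a driving array `w = k - c`, the true positions stay within `C` of `k t` minus the
deficits, where `C` bounds the initial positions. -/
theorem abs_particlePosition_sub_le {N : ℕ} [Nonempty (Fin N)] {w : ℕ → Fin N → Fin N → ℤ}
    {c : ℕ → Fin N → Fin N → ℕ} {k : ℤ} (hw : ∀ t i j, w t i j = k - c t i j)
    {x₀ : Fin N → ℝ} {C : ℝ} (hC : ∀ i, |x₀ i| ≤ C) (t : ℕ) (i : Fin N) :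
    |particlePosition w x₀ t i - (k * t - lossPath c 0 t i)| ≤ C := by
  induction t generalizing i with
  | zero => simpa [particlePosition, lossPath] using hC i
  | succ t ih =>
    have hp : particlePosition w x₀ (t + 1) i
        = ⨆ j, (particlePosition w x₀ t j + (w t i j : ℝ)) := rfl
    have hb : BddAbove (Set.range fun j => particlePosition w x₀ t j + (w t i j : ℝ)) :=
      (Set.finite_range _).bddAbove
    rw [abs_le]
    constructor
    · obtain ⟨j, hj⟩ : ∃ j, lossPath c 0 t j + c t i j = lossPath c 0 (t + 1) i :=
        ciInf_mem (fun j => lossPath c 0 t j + c t i j)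
      have h1 := le_ciSup hb j
      have h2 := (abs_le.1 (ih j)).1
      rw [hp, ← hj]
      rw [hw] at h1
      push_cast at h1 ⊢
      linarith
    · have : particlePosition w x₀ (t + 1) i
          ≤ C + (k * (t + 1 : ℕ) - lossPath c 0 (t + 1) i) := by
        rw [hp]
        refine ciSup_le fun j => ?_
        have h1 : (lossPath c 0 (t + 1) i : ℝ) ≤ lossPath c 0 t j + c t i j := by
          exact_mod_cast lossStep_le (c t) (lossPath c 0 t) i j
        have h2 := (abs_le.1 (ih j)).2
        rw [hw]
        push_cast
        linarith
      linarith

/-- If the deficit of the leader grows at rate `l` and the losses at time `t` are `o(t)`, then both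
ends of the front move at speed `k - l`, from every initial configuration. -/
theorem tendsto_front_of_tendsto_minLoss {N : ℕ} [Nonempty (Fin N)]
    {w : ℕ → Fin N → Fin N → ℤ} {c : ℕ → Fin N → Fin N → ℕ} {k : ℤ}
    (hw : ∀ t i j, w t i j = k - c t i j) {l : ℝ}
    (hl : Tendsto (fun t : ℕ => (minLoss c t : ℝ) / t) atTop (𝓝 l))
    (hs : Tendsto (fun t : ℕ => ((∑ i, ∑ j, c t i j : ℕ) : ℝ) / (t + 1 : ℕ)) atTop (𝓝 0))
    (x₀ : Fin N → ℝ) :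
    Tendsto (fun t : ℕ => (⨆ i : Fin N, particlePosition w x₀ t i) / (t : ℝ)) atTop
      (𝓝 (k - l)) ∧
    Tendsto (fun t : ℕ => (⨅ i : Fin N, particlePosition w x₀ t i) / (t : ℝ)) atTop
      (𝓝 (k - l)) := by
  obtain ⟨C, hC⟩ : ∃ C, ∀ i, |x₀ i| ≤ C :=
    ⟨_, fun i => le_ciSup (f := fun i => |x₀ i|) (Set.finite_range _).bddAbove i⟩
  have hpos := fun t i => abs_le.1 (abs_particlePosition_sub_le hw hC t i)
  have hC0 : Tendsto (fun t : ℕ => C / (t : ℝ)) atTop (𝓝 0) :=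
    tendsto_const_div_atTop_nhds_zero_nat C
  have hlow : Tendsto (fun t : ℕ => (k : ℝ) - (minLoss c t : ℝ) / t -
      ((∑ i, ∑ j, c (t - 1) i j : ℕ) : ℝ) / t - C / t) atTop (𝓝 (k - l)) := by
    have hs' : Tendsto (fun t : ℕ => ((∑ i, ∑ j, c (t - 1) i j : ℕ) : ℝ) / t) atTop (𝓝 0) := by
      rw [← tendsto_add_atTop_iff_nat 1]
      simpa using hs
    simpa using ((tendsto_const_nhds.sub hl).sub hs').sub hC0
  have hup : Tendsto (fun t : ℕ => (k : ℝ) - (minLoss c t : ℝ) / t + C / t) atTop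
      (𝓝 (k - l)) := by
    simpa using (tendsto_const_nhds.sub hl).add hC0
  have hbounds : ∀ᶠ t : ℕ in atTop, ∀ i,
      (k : ℝ) - (minLoss c t : ℝ) / t - ((∑ i, ∑ j, c (t - 1) i j : ℕ) : ℝ) / t - C / t
        ≤ particlePosition w x₀ t i / t ∧
      particlePosition w x₀ t i / t ≤ (k : ℝ) - (minLoss c t : ℝ) / t + C / t := by
    filter_upwards [eventually_ge_atTop 1] with t ht i
    have ht0 : (0 : ℝ) < t := by exact_mod_cast ht
    obtain ⟨s, rfl⟩ : ∃ s, t = s + 1 := ⟨t - 1, by lia⟩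
    have h1 : (minLoss c (s + 1) : ℝ) ≤ lossPath c 0 (s + 1) i := by
      exact_mod_cast minLoss_le c _ i
    have h2 : (lossPath c 0 (s + 1) i : ℝ) ≤ minLoss c (s + 1) + (∑ i, ∑ j, c s i j : ℕ) := by
      have := (le_maxLoss c (s + 1) i).trans (maxLoss_succ_le c s)
      have := minLoss_monotone c (Nat.le_succ s)
      exact_mod_cast (by grind)
    have h3 := hpos (s + 1) i
    have e1 : (k : ℝ) = k * (s + 1 : ℕ) / (s + 1 : ℕ) := by field_simp
    rw [e1, Nat.add_sub_cancel, ← sub_div, ← sub_div, ← sub_div, ← add_div]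
    constructor <;> apply div_le_div_of_nonneg_right _ ht0.le <;> linarith
  have hsup : ∀ t : ℕ, ∃ i, particlePosition w x₀ t i = ⨆ i, particlePosition w x₀ t i :=
    fun t => exists_eq_ciSup_of_finite
  have hinf : ∀ t : ℕ, ∃ i, particlePosition w x₀ t i = ⨅ i, particlePosition w x₀ t i :=
    fun t => exists_eq_ciInf_of_finite
  constructor
  · refine tendsto_of_tendsto_of_tendsto_of_le_of_le' hlow hup ?_ ?_ <;>
      filter_upwards [hbounds] with t ht <;> obtain ⟨i, hi⟩ := hsup t <;> rw [← hi]
    exacts [(ht i).1, (ht i).2]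
  · refine tendsto_of_tendsto_of_tendsto_of_le_of_le' hlow hup ?_ ?_ <;>
      filter_upwards [hbounds] with t ht <;> obtain ⟨i, hi⟩ := hinf t <;> rw [← hi]
    exacts [(ht i).1, (ht i).2]

/-! ### Independent losses -/

section Law

variable (ι : Type*) [Fintype ι] (κ : Measure ℕ)

/-- The law of a matrix of independent losses with law `κ`. -/
noncomputable def lossMatrixLaw : Measure (ι → ι → ℕ) :=
  Measure.pi fun _ => Measure.pi fun _ => κ

/-- The law of an independent sequence of loss matrices. -/
noncomputable def lossLaw : Measure (ℕ → ι → ι → ℕ) :=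
  Measure.infinitePi fun _ => lossMatrixLaw ι κ

variable [IsProbabilityMeasure κ]

instance : IsProbabilityMeasure (lossMatrixLaw ι κ) := by
  unfold lossMatrixLaw; infer_instance

instance : IsProbabilityMeasure (lossLaw ι κ) := by
  unfold lossLaw; infer_instance

end Law

/-! ### Existence of the rate of loss -/

/-- If the averages of the deficits of the leader and of the last particle over blocks of `n` steps
converge to `e` and `E`, then `minLoss c t / t` is asymptotically between `e / n` and `E / n`. -/
theorem eventually_minLoss_div_of_block_averages {ι : Type*} [Fintype ι] [Nonempty ι]
    {c : ℕ → ι → ι → ℕ} {n : ℕ} (hn : 1 ≤ n) {e E : ℝ}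
    (he : Tendsto (fun m : ℕ =>
      ((∑ b ∈ Finset.range m, minLoss (fun r => c (n * b + r)) n : ℕ) : ℝ) / m) atTop (𝓝 e))
    (hE : Tendsto (fun m : ℕ =>
      ((∑ b ∈ Finset.range m, maxLoss (fun r => c (n * b + r)) n : ℕ) : ℝ) / m) atTop (𝓝 E)) :
    (∀ x < e / n, ∀ᶠ t : ℕ in atTop, x < (minLoss c t : ℝ) / t) ∧
      (∀ x > E / n, ∀ᶠ t : ℕ in atTop, (minLoss c t : ℝ) / t < x) := by
  have hn0 : (0 : ℝ) < n := by exact_mod_cast hn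
  have hdiv : Tendsto (fun t : ℕ => t / n) atTop atTop := Nat.tendsto_div_const_atTop (by lia)
  have hrat : Tendsto (fun t : ℕ => ((t / n : ℕ) : ℝ) / t) atTop (𝓝 (1 / n)) := by
    have := (tendsto_nat_floor_mul_div_atTop (R := ℝ) (a := 1 / n) (by positivity)).comp
      tendsto_natCast_atTop_atTop
    refine this.congr fun t => ?_
    simp only [Function.comp]
    rw [one_div_mul_eq_div, Nat.floor_div_eq_div]
  have hrat' : Tendsto (fun t : ℕ => ((t / n + 1 : ℕ) : ℝ) / t) atTop (𝓝 (1 / n)) := by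
    have := hrat.add tendsto_one_div_atTop_nhds_zero_nat
    rw [add_zero] at this
    refine this.congr fun t => ?_
    push_cast
    rw [add_div]
  have hlow := (he.comp hdiv).mul hrat
  have hup := (hE.comp ((tendsto_add_atTop_nat 1).comp hdiv)).mul hrat'
  rw [mul_one_div] at hlow hup
  constructor
  · intro x hx
    filter_upwards [hlow.eventually_const_lt hx, eventually_ge_atTop n] with t ht htn
    refine ht.trans_le ?_
    have hm : 1 ≤ t / n := Nat.div_pos htn hn
    have hm0 : ((t / n : ℕ) : ℝ) ≠ 0 := by positivity
    simp only [Function.comp]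
    rw [div_mul_div_cancel₀ hm0]
    refine div_le_div_of_nonneg_right ?_ (by positivity)
    exact_mod_cast (sum_block_minLoss_le c n (t / n)).trans
      (minLoss_monotone c (Nat.mul_div_le t n))
  · intro x hx
    filter_upwards [hup.eventually_lt_const hx] with t ht
    refine lt_of_le_of_lt ?_ ht
    have hm0 : ((t / n + 1 : ℕ) : ℝ) ≠ 0 := by positivity
    simp only [Function.comp]
    rw [div_mul_div_cancel₀ hm0]
    refine div_le_div_of_nonneg_right ?_ (by positivity)
    exact_mod_cast (minLoss_monotone c (Nat.lt_mul_div_succ t hn).le).trans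
      ((minLoss_le_maxLoss c _).trans (maxLoss_le_sum_block c n (t / n + 1)))

section Stationarity

variable {ι : Type*} [Fintype ι] {κ : Measure ℕ} [IsProbabilityMeasure κ]

theorem map_shift_lossLaw (a : ℕ) :
    (lossLaw ι κ).map (fun c r => c (a + r)) = lossLaw ι κ :=
  Measure.map_infinitePi_infinitePi_of_inj (P := fun _ => lossMatrixLaw ι κ)
    (f := fun r => a + r) (add_right_injective a)

theorem map_eval_lossLaw (t : ℕ) :
    (lossLaw ι κ).map (fun c => c t) = lossMatrixLaw ι κ :=
  Measure.infinitePi_map_eval _ t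

theorem measurable_lossPath {Ω : Type*} {m : MeasurableSpace Ω} {c : Ω → ℕ → ι → ι → ℕ}
    (y : ι → ℕ) {n : ℕ} (hc : ∀ t < n, Measurable fun ω => c ω t) :
    Measurable fun ω => lossPath (c ω) y n := by
  induction n with
  | zero => exact measurable_const
  | succ n ih =>
    have h1 := (hc n n.lt_succ_self).prodMk (ih fun t ht => hc t (ht.trans n.lt_succ_self))
    exact (Measurable.of_discrete (f := fun p : (ι → ι → ℕ) × (ι → ℕ) => lossStep p.1 p.2)).comp h1

/-- Functions of the losses at disjoint sets of times are independent. -/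
theorem indepFun_of_disjoint_times {α β : Type*} [MeasurableSpace α] [MeasurableSpace β]
    {S T : Set ℕ} (hST : Disjoint S T)
    {f : (ℕ → ι → ι → ℕ) → α} {g : (ℕ → ι → ι → ℕ) → β}
    (hf : ∀ m : MeasurableSpace (ℕ → ι → ι → ℕ), (∀ t ∈ S, Measurable[m] fun c => c t) →
      Measurable[m] f)
    (hg : ∀ m : MeasurableSpace (ℕ → ι → ι → ℕ), (∀ t ∈ T, Measurable[m] fun c => c t) →
      Measurable[m] g) :
    IndepFun f g (lossLaw ι κ) := by
  have hind : iIndepFun (fun (t : ℕ) (c : ℕ → ι → ι → ℕ) => c t) (lossLaw ι κ) :=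
    iIndepFun_infinitePi (P := fun _ => lossMatrixLaw ι κ) (X := fun _ c => c)
      (fun _ => measurable_id)
  have h := indep_iSup_of_disjoint (fun t => (measurable_pi_apply t).comap_le) hind hST
  rw [IndepFun_iff_Indep]
  refine indep_of_indep_of_le_left (indep_of_indep_of_le_right h ?_) ?_
  · refine Measurable.comap_le (hg _ fun t ht => ?_)
    exact Measurable.of_comap_le (le_iSup₂_of_le t ht le_rfl)
  · refine Measurable.comap_le (hf _ fun t ht => ?_)
    exact Measurable.of_comap_le (le_iSup₂_of_le t ht le_rfl)

theorem integrable_sum_lossMatrixLaw (hκ : Integrable (fun n : ℕ => (n : ℝ)) κ) :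
    Integrable (fun c : ι → ι → ℕ => ((∑ i, ∑ j, c i j : ℕ) : ℝ)) (lossMatrixLaw ι κ) := by
  push_cast
  refine integrable_finsetSum _ fun i _ => integrable_finsetSum _ fun j _ => ?_
  have h : Integrable (fun r : ι → ℕ => (r j : ℝ)) (Measure.pi fun _ => κ) :=
    integrable_comp_eval (μ := fun _ => κ) (i := j) (f := fun n : ℕ => (n : ℝ)) hκ
  exact integrable_comp_eval (μ := fun _ => Measure.pi fun _ => κ) (i := i)
    (f := fun r : ι → ℕ => (r j : ℝ)) h

theorem integrable_sum_lossLaw (hκ : Integrable (fun n : ℕ => (n : ℝ)) κ) (t : ℕ) :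
    Integrable (fun c : ℕ → ι → ι → ℕ => ((∑ i, ∑ j, c t i j : ℕ) : ℝ)) (lossLaw ι κ) := by
  have h := integrable_sum_lossMatrixLaw (ι := ι) hκ
  rw [← map_eval_lossLaw t] at h
  exact h.comp_measurable (measurable_pi_apply t)

theorem integral_sum_lossLaw (t : ℕ) :
    ∫ c : ℕ → ι → ι → ℕ, ((∑ i, ∑ j, c t i j : ℕ) : ℝ) ∂lossLaw ι κ
      = ∫ c : ι → ι → ℕ, ((∑ i, ∑ j, c i j : ℕ) : ℝ) ∂lossMatrixLaw ι κ := by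
  rw [← map_eval_lossLaw t, integral_map (measurable_pi_apply t).aemeasurable
    Measurable.of_discrete.aestronglyMeasurable]

theorem measurable_minLoss {Ω : Type*} {m : MeasurableSpace Ω} {c : Ω → ℕ → ι → ι → ℕ} {n : ℕ}
    (hc : ∀ t < n, Measurable fun ω => c ω t) : Measurable fun ω => minLoss (c ω) n :=
  (Measurable.of_discrete (f := fun y : ι → ℕ => ⨅ i, y i)).comp (measurable_lossPath 0 hc)

theorem measurable_maxLoss {Ω : Type*} {m : MeasurableSpace Ω} {c : Ω → ℕ → ι → ι → ℕ} {n : ℕ}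
    (hc : ∀ t < n, Measurable fun ω => c ω t) : Measurable fun ω => maxLoss (c ω) n :=
  (Measurable.of_discrete (f := fun y : ι → ℕ => ⨆ i, y i)).comp (measurable_lossPath 0 hc)

theorem integrable_minLoss [Nonempty ι] (hκ : Integrable (fun n : ℕ => (n : ℝ)) κ) (n : ℕ) :
    Integrable (fun c => (minLoss c n : ℝ)) (lossLaw ι κ) := by
  refine Integrable.mono' (integrable_finsetSum (Finset.range n) fun s _ =>
    integrable_sum_lossLaw (ι := ι) hκ s) ?_ (ae_of_all _ fun c => ?_)
  · exact (Measurable.of_discrete.comp (measurable_minLoss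
      fun t _ => measurable_pi_apply t)).aestronglyMeasurable
  · rw [Real.norm_of_nonneg (by positivity)]
    exact_mod_cast minLoss_le_sum c n

theorem integrable_maxLoss [Nonempty ι] (hκ : Integrable (fun n : ℕ => (n : ℝ)) κ) (n : ℕ) :
    Integrable (fun c => (maxLoss c n : ℝ)) (lossLaw ι κ) := by
  cases n with
  | zero => simp [maxLoss, lossPath]
  | succ n =>
    refine Integrable.mono' ((integrable_minLoss hκ n).add (integrable_sum_lossLaw (ι := ι) hκ n))
      ?_ (ae_of_all _ fun c => ?_)
    · exact (Measurable.of_discrete.comp (measurable_maxLoss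
        fun t _ => measurable_pi_apply t)).aestronglyMeasurable
    · rw [Real.norm_of_nonneg (by positivity)]
      simp only [Pi.add_apply]
      exact_mod_cast maxLoss_succ_le c n

/-- Strong law of large numbers for a statistic of the losses in consecutive blocks of `n` steps. -/
theorem tendsto_block_average {n : ℕ} {f : (ℕ → ι → ι → ℕ) → ℕ}
    (hf : ∀ {_ : MeasurableSpace (ℕ → ι → ι → ℕ)} {g : (ℕ → ι → ι → ℕ) → ℕ → ι → ι → ℕ},
      (∀ t < n, Measurable fun c => g c t) → Measurable fun c => f (g c))
    (hint : Integrable (fun c => (f c : ℝ)) (lossLaw ι κ)) :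
    ∀ᵐ c ∂lossLaw ι κ, Tendsto (fun m : ℕ =>
      ((∑ b ∈ Finset.range m, f (fun r => c (n * b + r)) : ℕ) : ℝ) / m) atTop
      (𝓝 (∫ c, (f c : ℝ) ∂lossLaw ι κ)) := by
  have hfm : Measurable (fun c : ℕ → ι → ι → ℕ => (f c : ℝ)) :=
    Measurable.of_discrete.comp (hf fun t _ => measurable_pi_apply t)
  have h := strong_law_ae_real (μ := lossLaw ι κ)
    (fun b c => (f (fun r => c (n * b + r)) : ℝ)) (by simpa using hint) ?_ ?_
  · simpa using h
  · intro a b hab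
    refine indepFun_of_disjoint_times (S := Set.Ico (n * a) (n * (a + 1)))
      (T := Set.Ico (n * b) (n * (b + 1))) ?_ ?_ ?_
    · rw [Set.Ico_disjoint_Ico]
      rcases lt_or_gt_of_ne hab with h | h
      · refine (min_le_left _ _).trans ((Nat.mul_le_mul_left n ?_).trans (le_max_right _ _))
        exact h
      · refine (min_le_right _ _).trans ((Nat.mul_le_mul_left n ?_).trans (le_max_left _ _))
        exact h
    all_goals
      intro m hm
      refine Measurable.of_discrete.comp (hf fun t ht => hm _ ⟨Nat.le_add_right _ _, ?_⟩)
      rw [mul_add_one]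
      exact Nat.add_lt_add_left ht _
  · intro b
    have hs : Measurable (fun (c : ℕ → ι → ι → ℕ) r => c (n * b + r)) :=
      measurable_pi_lambda _ fun r => measurable_pi_apply _
    refine ⟨(hfm.comp hs).aemeasurable, by simpa using hfm.aemeasurable, ?_⟩
    have e : (lossLaw ι κ).map (fun c => (f (fun r => c (n * b + r)) : ℝ))
        = ((lossLaw ι κ).map (fun c r => c (n * b + r))).map (fun c => (f c : ℝ)) := by
      rw [Measure.map_map hfm hs]; rfl
    rw [e, map_shift_lossLaw]
    simp

/-- The deficit of the leader grows linearly: there is a rate `l` such that almost surely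
`minLoss c t / t → l`, and the expected deficit at time `n` is `n l` up to a bounded error. -/
theorem exists_lossRate [Nonempty ι] (hκ : Integrable (fun n : ℕ => (n : ℝ)) κ) :
    ∃ l C : ℝ, (∀ᵐ c ∂lossLaw ι κ, Tendsto (fun t : ℕ => (minLoss c t : ℝ) / t) atTop (𝓝 l)) ∧
      ∀ n : ℕ, 1 ≤ n → ∫ c, (minLoss c n : ℝ) ∂lossLaw ι κ ≤ n * l ∧
        n * l ≤ ∫ c, (minLoss c n : ℝ) ∂lossLaw ι κ + C := by
  set C := ∫ c : ι → ι → ℕ, ((∑ i, ∑ j, c i j : ℕ) : ℝ) ∂lossMatrixLaw ι κ with hC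
  set e := fun n : ℕ => ∫ c, (minLoss c n : ℝ) ∂lossLaw ι κ with he
  set E := fun n : ℕ => ∫ c, (maxLoss c n : ℝ) ∂lossLaw ι κ with hE
  have hEe : ∀ n, 1 ≤ n → E n ≤ e n + C := by
    intro n hn
    obtain ⟨s, rfl⟩ : ∃ s, n = s + 1 := ⟨n - 1, by lia⟩
    rw [hC, ← integral_sum_lossLaw s, he, hE, ← integral_add (integrable_minLoss hκ _)
      (integrable_sum_lossLaw hκ s)]
    refine integral_mono (integrable_maxLoss hκ _)
      ((integrable_minLoss hκ _).add (integrable_sum_lossLaw hκ s)) fun c => ?_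
    have h1 := maxLoss_succ_le c s
    have h2 := minLoss_monotone c s.le_succ
    have h3 := h1.trans (Nat.add_le_add_right h2 _)
    simp only [Nat.succ_eq_add_one] at h3 ⊢
    exact_mod_cast h3
  -- Almost surely, for every block length, the block averages converge.
  have hae : ∀ᵐ c ∂lossLaw ι κ, ∀ n,
      Tendsto (fun m : ℕ =>
          ((∑ b ∈ Finset.range m, minLoss (fun r => c (n * b + r)) n : ℕ) : ℝ) / m)
        atTop (𝓝 (e n)) ∧
      Tendsto (fun m : ℕ =>
          ((∑ b ∈ Finset.range m, maxLoss (fun r => c (n * b + r)) n : ℕ) : ℝ) / m)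
        atTop (𝓝 (E n)) := by
    rw [ae_all_iff]
    intro n
    exact (tendsto_block_average (f := fun c => minLoss c n) measurable_minLoss
      (integrable_minLoss hκ n)).and (tendsto_block_average (f := fun c => maxLoss c n)
        measurable_maxLoss (integrable_maxLoss hκ n))
  have hcomp : ∀ n m, 1 ≤ n → 1 ≤ m → e n / n ≤ E m / m := by
    obtain ⟨c, hc⟩ := hae.exists
    intro n m hn hm
    by_contra! hlt
    obtain ⟨x, hx1, hx2⟩ := exists_between hlt
    obtain ⟨t, ht1, ht2⟩ :=
      (((eventually_minLoss_div_of_block_averages hn (hc n).1 (hc n).2).1 x hx2).and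
        ((eventually_minLoss_div_of_block_averages hm (hc m).1 (hc m).2).2 x hx1)).exists
    exact lt_asymm ht1 ht2
  have hbdd : BddAbove (Set.range fun n : ℕ => e (n + 1) / (n + 1 : ℕ)) := by
    refine ⟨E 1 / (1 : ℕ), ?_⟩
    rintro _ ⟨n, rfl⟩
    exact hcomp _ 1 (by lia) le_rfl
  set l := ⨆ n : ℕ, e (n + 1) / (n + 1 : ℕ) with hl
  have hel : ∀ n, 1 ≤ n → e n / n ≤ l := by
    intro n hn
    obtain ⟨s, rfl⟩ : ∃ s, n = s + 1 := ⟨n - 1, by lia⟩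
    exact le_ciSup hbdd s
  have hlE : ∀ n, 1 ≤ n → l ≤ E n / n := fun n hn => ciSup_le fun s => hcomp _ n (by lia) hn
  have hlE' : ∀ n : ℕ, 1 ≤ n → l ≤ e n / n + C / n := fun n hn => by
    rw [← add_div]
    exact (hlE n hn).trans (div_le_div_of_nonneg_right (hEe n hn) (by positivity))
  have hEl : ∀ n : ℕ, 1 ≤ n → E n / n ≤ l + C / n := fun n hn => by
    refine (div_le_div_of_nonneg_right (hEe n hn) (by positivity)).trans ?_
    rw [add_div]
    linarith [hel n hn]
  refine ⟨l, C, ?_, ?_⟩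
  · filter_upwards [hae] with c hc
    have hCn : Tendsto (fun n : ℕ => C / (n : ℝ)) atTop (𝓝 0) :=
      tendsto_const_div_atTop_nhds_zero_nat C
    refine tendsto_order.2 ⟨fun x hx => ?_, fun x hx => ?_⟩
    · obtain ⟨n, hn, hn1⟩ := ((hCn.eventually_lt_const (sub_pos.2 hx)).and
        (eventually_ge_atTop 1)).exists
      exact (eventually_minLoss_div_of_block_averages hn1 (hc n).1 (hc n).2).1 x
        (by linarith [hlE' n hn1])
    · obtain ⟨n, hn, hn1⟩ := ((hCn.eventually_lt_const (sub_pos.2 hx)).and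
        (eventually_ge_atTop 1)).exists
      exact (eventually_minLoss_div_of_block_averages hn1 (hc n).1 (hc n).2).2 x
        (by linarith [hEl n hn1])
  · intro n hn
    have hn0 : (0 : ℝ) < n := by exact_mod_cast hn
    constructor
    · have := hel n hn
      rw [div_le_iff₀ hn0] at this
      linarith
    · have := hlE' n hn
      rw [← add_div, le_div_iff₀ hn0] at this
      linarith

/-- The total loss at time `t` is almost surely `o(t)`. -/
theorem tendsto_sum_loss_div (hκ : Integrable (fun n : ℕ => (n : ℝ)) κ) :
    ∀ᵐ c ∂lossLaw ι κ,
      Tendsto (fun t : ℕ => ((∑ i, ∑ j, c t i j : ℕ) : ℝ) / (t + 1 : ℕ)) atTop (𝓝 0) := by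
  have h := tendsto_block_average (ι := ι) (κ := κ) (n := 1) (f := fun c => ∑ i, ∑ j, c 0 i j)
    (fun hc => (Measurable.of_discrete
      (f := fun a : ι → ι → ℕ => ∑ i, ∑ j, a i j)).comp (hc 0 one_pos))
    (integrable_sum_lossLaw hκ 0)
  filter_upwards [h] with c hc
  have h1 := (tendsto_add_atTop_iff_nat 1).2 hc
  have h2 : Tendsto (fun t : ℕ => (t : ℝ) / (t + 1 : ℕ)) atTop (𝓝 1) := by
    simpa using tendsto_natCast_div_add_atTop (1 : ℝ)
  have h3 := h1.sub (hc.mul h2)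
  rw [mul_one, sub_self] at h3
  refine h3.congr' ?_
  filter_upwards [eventually_ge_atTop 1] with t ht
  have ht0 : (t : ℝ) ≠ 0 := by positivity
  rw [div_mul_div_cancel₀ ht0, ← sub_div, Finset.sum_range_succ]
  push_cast
  congr 1
  simp

end Stationarity

/-! ### The Markov property and drift bounds -/

section Drift

variable {ι : Type*} [Fintype ι] [Nonempty ι] {κ : Measure ℕ} [IsProbabilityMeasure κ]

theorem integrable_iInf_lossStep_add (hκ : Integrable (fun n : ℕ => (n : ℝ)) κ)
    {φ : (ι → ℕ) → ℝ} {B : ℝ} (hφ : ∀ y, |φ y| ≤ B) (y : ι → ℕ) :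
    Integrable (fun c => ((⨅ i, lossStep c y i : ℕ) : ℝ) + φ (lossStep c y))
      (lossMatrixLaw ι κ) := by
  refine Integrable.add ?_ (Integrable.of_bound Measurable.of_discrete.aestronglyMeasurable B
    (ae_of_all _ fun c => hφ _))
  refine Integrable.mono' ((integrable_const ((⨅ i, y i : ℕ) : ℝ)).add
    (integrable_sum_lossMatrixLaw hκ)) Measurable.of_discrete.aestronglyMeasurable
    (ae_of_all _ fun c => ?_)
  rw [Real.norm_of_nonneg (by positivity)]
  have h := (ciInf_le' (lossStep c y) (Classical.arbitrary ι)).trans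
    (lossStep_le_iInf_add_sum c y _)
  simp only [Pi.add_apply]
  exact_mod_cast h

theorem integrable_minLoss_add (hκ : Integrable (fun n : ℕ => (n : ℝ)) κ)
    {φ : (ι → ℕ) → ℝ} {B : ℝ} (hφ : ∀ y, |φ y| ≤ B) (n : ℕ) :
    Integrable (fun c => (minLoss c n : ℝ) + φ (lossPath c 0 n)) (lossLaw ι κ) :=
  (integrable_minLoss hκ n).add (Integrable.of_bound (Measurable.of_discrete.comp
    (measurable_lossPath 0 fun t _ => measurable_pi_apply t)).aestronglyMeasurable B
    (ae_of_all _ fun _ => hφ _))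

/-- The Markov property of the deficits, tested against the leader's deficit plus a bounded
function of the configuration. -/
theorem integral_minLoss_add_succ (hκ : Integrable (fun n : ℕ => (n : ℝ)) κ)
    {φ : (ι → ℕ) → ℝ} {B : ℝ} (hφ : ∀ y, |φ y| ≤ B) (n : ℕ) :
    Integrable (fun c => ∫ a, ((⨅ i, lossStep a (lossPath c 0 n) i : ℕ) : ℝ) +
      φ (lossStep a (lossPath c 0 n)) ∂lossMatrixLaw ι κ) (lossLaw ι κ) ∧
    ∫ c, (minLoss c (n + 1) : ℝ) + φ (lossPath c 0 (n + 1)) ∂lossLaw ι κ =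
      ∫ c, (∫ a, ((⨅ i, lossStep a (lossPath c 0 n) i : ℕ) : ℝ) +
        φ (lossStep a (lossPath c 0 n)) ∂lossMatrixLaw ι κ) ∂lossLaw ι κ := by
  have hY : Measurable fun c : ℕ → ι → ι → ℕ => lossPath c 0 n :=
    measurable_lossPath 0 fun t _ => measurable_pi_apply t
  have hW : Measurable fun c : ℕ → ι → ι → ℕ => c n := measurable_pi_apply n
  have hind : IndepFun (fun c : ℕ → ι → ι → ℕ => lossPath c 0 n) (fun c => c n)
      (lossLaw ι κ) := by
    refine indepFun_of_disjoint_times (S := Set.Iio n) (T := {n}) (by simp) ?_ ?_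
    · intro m hm
      exact measurable_lossPath 0 hm
    · intro m hm
      exact hm n rfl
  rw [indepFun_iff_map_prod_eq_prod_map_map hY.aemeasurable hW.aemeasurable,
    map_eval_lossLaw] at hind
  set G : (ι → ℕ) × (ι → ι → ℕ) → ℝ := fun p =>
    ((⨅ i, lossStep p.2 p.1 i : ℕ) : ℝ) + φ (lossStep p.2 p.1) with hG
  have hGm : Measurable G := Measurable.of_discrete
  have hint : Integrable G (((lossLaw ι κ).map fun c => lossPath c 0 n).prod
      (lossMatrixLaw ι κ)) := by
    rw [← hind, integrable_map_measure hGm.aestronglyMeasurable (hY.prodMk hW).aemeasurable]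
    exact integrable_minLoss_add hκ hφ (n + 1)
  have hprob : IsProbabilityMeasure ((lossLaw ι κ).map fun c => lossPath c 0 n) :=
    Measure.isProbabilityMeasure_map hY.aemeasurable
  have hfst := hint.integral_prod_left
  constructor
  · exact hfst.comp_measurable hY
  · have h1 := integral_prod G hint
    rw [← hind, integral_map (hY.prodMk hW).aemeasurable hGm.aestronglyMeasurable,
      integral_map hY.aemeasurable Measurable.of_discrete.aestronglyMeasurable] at h1
    exact h1

/-- A one-step upper bound on the drift of `⨅ y + φ y` bounds the expected deficit. -/
theorem integral_minLoss_add_le (hκ : Integrable (fun n : ℕ => (n : ℝ)) κ)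
    {φ : (ι → ℕ) → ℝ} {B K : ℝ} (hφ : ∀ y, |φ y| ≤ B)
    (hK : ∀ y, ∫ a, ((⨅ i, lossStep a y i : ℕ) : ℝ) + φ (lossStep a y) ∂lossMatrixLaw ι κ ≤
      ((⨅ i, y i : ℕ) : ℝ) + φ y + K) (n : ℕ) :
    ∫ c, (minLoss c n : ℝ) + φ (lossPath c 0 n) ∂lossLaw ι κ ≤ φ 0 + n * K := by
  induction n with
  | zero => simp [minLoss, lossPath]
  | succ n ih =>
    obtain ⟨h1, h2⟩ := integral_minLoss_add_succ hκ hφ n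
    have h3 := integral_mono h1 ((integrable_minLoss_add hκ hφ n).add (integrable_const K))
      fun c => hK (lossPath c 0 n)
    rw [h2]
    refine h3.trans ?_
    rw [integral_add' (integrable_minLoss_add hκ hφ n) (integrable_const K)]
    simp only [integral_const, probReal_univ, one_smul]
    push_cast
    linarith

/-- A one-step lower bound on the drift of `⨅ y + φ y` bounds the expected deficit. -/
theorem le_integral_minLoss_add (hκ : Integrable (fun n : ℕ => (n : ℝ)) κ)
    {φ : (ι → ℕ) → ℝ} {B K : ℝ} (hφ : ∀ y, |φ y| ≤ B)
    (hK : ∀ y, ((⨅ i, y i : ℕ) : ℝ) + φ y + K ≤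
      ∫ a, ((⨅ i, lossStep a y i : ℕ) : ℝ) + φ (lossStep a y) ∂lossMatrixLaw ι κ) (n : ℕ) :
    φ 0 + n * K ≤ ∫ c, (minLoss c n : ℝ) + φ (lossPath c 0 n) ∂lossLaw ι κ := by
  induction n with
  | zero => simp [minLoss, lossPath]
  | succ n ih =>
    obtain ⟨h1, h2⟩ := integral_minLoss_add_succ hκ hφ n
    have h3 := integral_mono ((integrable_minLoss_add hκ hφ n).add (integrable_const K)) h1
      fun c => hK (lossPath c 0 n)
    rw [h2]
    refine le_trans ?_ h3
    rw [integral_add' (integrable_minLoss_add hκ hφ n) (integrable_const K)]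
    simp only [integral_const, probReal_univ, one_smul]
    push_cast
    linarith

end Drift

/-! ### One step of the set of leaders -/

section OneStep

variable {ι : Type*} [Fintype ι]

open scoped Classical in
/-- The particles at the front. -/
noncomputable def leaders (y : ι → ℕ) : Finset ι :=
  Finset.univ.filter fun i => y i = ⨅ j, y j

open scoped Classical in
/-- The particles that receive a loss-free jump from some member of `A`. -/
noncomputable def reached (A : Finset ι) (c : ι → ι → ℕ) : Finset ι :=
  Finset.univ.filter fun i => ∃ j ∈ A, c i j = 0

theorem mem_leaders {y : ι → ℕ} {i : ι} : i ∈ leaders y ↔ y i = ⨅ j, y j := by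
  simp [leaders]

theorem mem_reached {A : Finset ι} {c : ι → ι → ℕ} {i : ι} :
    i ∈ reached A c ↔ ∃ j ∈ A, c i j = 0 := by
  simp [reached]

theorem leaders_nonempty [Nonempty ι] (y : ι → ℕ) : (leaders y).Nonempty := by
  obtain ⟨i, hi⟩ := ciInf_mem y
  exact ⟨i, mem_leaders.2 hi⟩

theorem mem_reached_leaders_iff [Nonempty ι] {c : ι → ι → ℕ} {y : ι → ℕ} {i : ι} :
    i ∈ reached (leaders y) c ↔ lossStep c y i ≤ ⨅ j, y j := by
  rw [mem_reached]
  constructor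
  · rintro ⟨j, hj, h0⟩
    have := lossStep_le c y i j
    rwa [h0, mem_leaders.1 hj, add_zero] at this
  · intro h
    obtain ⟨j, hj⟩ : ∃ j, y j + c i j = lossStep c y i := ciInf_mem _
    have hle := ciInf_le' y j
    refine ⟨j, mem_leaders.2 ?_, ?_⟩ <;> lia

theorem iInf_lossStep_of_reached_nonempty [Nonempty ι] {c : ι → ι → ℕ} {y : ι → ℕ}
    (h : (reached (leaders y) c).Nonempty) : ⨅ i, lossStep c y i = ⨅ i, y i := by
  obtain ⟨i, hi⟩ := h
  exact le_antisymm ((ciInf_le' _ i).trans (mem_reached_leaders_iff.1 hi))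
    (iInf_le_iInf_lossStep c y)

theorem leaders_lossStep_of_reached_nonempty [Nonempty ι] {c : ι → ι → ℕ} {y : ι → ℕ}
    (h : (reached (leaders y) c).Nonempty) : leaders (lossStep c y) = reached (leaders y) c := by
  ext i
  rw [mem_leaders, mem_reached_leaders_iff, iInf_lossStep_of_reached_nonempty h]
  exact ⟨fun h => h.le, fun h => le_antisymm h
    ((iInf_le_iInf_lossStep c y).trans (ciInf_le' _ i))⟩

theorem iInf_add_one_le_of_reached_eq_empty [Nonempty ι] {c : ι → ι → ℕ} {y : ι → ℕ}
    (h : reached (leaders y) c = ∅) : (⨅ i, y i) + 1 ≤ ⨅ i, lossStep c y i := by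
  refine le_ciInf fun i => ?_
  have : i ∉ reached (leaders y) c := by simp [h]
  rw [mem_reached_leaders_iff] at this
  lia

variable {κ : Measure ℕ} [IsProbabilityMeasure κ]

theorem pi_real_forall_ne_zero (A : Finset ι) :
    (Measure.pi fun _ : ι => κ).real {r | ∀ j ∈ A, r j ≠ 0} = κ.real {0}ᶜ ^ A.card := by
  classical
  have : {r : ι → ℕ | ∀ j ∈ A, r j ≠ 0}
      = Set.univ.pi fun j => if j ∈ A then {0}ᶜ else Set.univ := by
    ext r
    simp only [Set.mem_ofPred_eq, Set.mem_pi, Set.mem_univ, true_imp_iff]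
    refine forall_congr' fun j => ?_
    by_cases hj : j ∈ A <;> simp [hj]
  rw [this, Measure.real, Measure.pi_pi, ENNReal.toReal_prod]
  simp only [apply_ite, measure_univ, ENNReal.toReal_one]
  rw [Finset.prod_ite_mem, Finset.univ_inter, Finset.prod_const]
  rfl

theorem lossMatrixLaw_real_reached_eq (A T : Finset ι) :
    (lossMatrixLaw ι κ).real {c | reached A c = T} =
      (1 - κ.real {0}ᶜ ^ A.card) ^ T.card *
        (κ.real {0}ᶜ ^ A.card) ^ (Fintype.card ι - T.card) := by
  classical
  set R : Set (ι → ℕ) := {r | ∀ j ∈ A, r j ≠ 0} with hR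
  have : {c : ι → ι → ℕ | reached A c = T} = Set.univ.pi fun i => if i ∈ T then Rᶜ else R := by
    ext c
    simp only [Set.mem_ofPred_eq, Set.mem_pi, Set.mem_univ, true_imp_iff, Finset.ext_iff]
    refine forall_congr' fun i => ?_
    by_cases hi : i ∈ T <;> simp [hi, hR, mem_reached]
  rw [this, lossMatrixLaw, Measure.real, Measure.pi_pi, ENNReal.toReal_prod]
  simp only [apply_ite]
  have hRc : ((Measure.pi fun _ : ι => κ) Rᶜ).toReal = 1 - κ.real {0}ᶜ ^ A.card := by
    rw [← pi_real_forall_ne_zero A]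
    exact probReal_compl_eq_one_sub MeasurableSet.of_discrete
  have hR' : ((Measure.pi fun _ : ι => κ) R).toReal = κ.real {0}ᶜ ^ A.card :=
    pi_real_forall_ne_zero A
  simp only [hRc, hR']
  rw [Finset.prod_ite]
  simp only [Finset.prod_const]
  congr 2
  · congr 1; ext; simp
  · rw [← Finset.card_univ, ← Finset.card_sdiff_of_subset (Finset.subset_univ T)]
    congr 1; ext; simp

/-- The number of particles reached from `A` is binomial with parameters `card ι` and
`1 - q ^ #A`, where `q` is the probability of a positive loss. -/
theorem integral_card_reached (A : Finset ι) (ψ : ℕ → ℝ) :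
    ∫ c, ψ (reached A c).card ∂lossMatrixLaw ι κ =
      ∑ s ∈ Finset.range (Fintype.card ι + 1), (Fintype.card ι).choose s *
        ((1 - κ.real {0}ᶜ ^ A.card) ^ s * (κ.real {0}ᶜ ^ A.card) ^ (Fintype.card ι - s) * ψ s) := by
  classical
  let _ : MeasurableSpace (Finset ι) := ⊤
  have hm : Measurable (reached A) := Measurable.of_discrete
  have h1 : ∫ c, ψ (reached A c).card ∂lossMatrixLaw ι κ
      = ∫ T, ψ T.card ∂(lossMatrixLaw ι κ).map (reached A) :=
    (integral_map (f := fun T : Finset ι => ψ T.card) hm.aemeasurable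
      Measurable.of_discrete.aestronglyMeasurable).symm
  have : IsProbabilityMeasure ((lossMatrixLaw ι κ).map (reached A)) :=
    Measure.isProbabilityMeasure_map hm.aemeasurable
  rw [h1, integral_fintype .of_finite, ← Finset.powerset_univ]
  have h2 : ∀ T : Finset ι, ((lossMatrixLaw ι κ).map (reached A)).real {T} • ψ T.card
      = (1 - κ.real {0}ᶜ ^ A.card) ^ T.card *
        (κ.real {0}ᶜ ^ A.card) ^ (Fintype.card ι - T.card) * ψ T.card := by
    intro T
    rw [map_measureReal_apply hm MeasurableSet.of_discrete, smul_eq_mul]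
    congr 1
    exact lossMatrixLaw_real_reached_eq A T
  simp only [h2]
  rw [Finset.sum_powerset_apply_card (fun s => (1 - κ.real {0}ᶜ ^ A.card) ^ s *
        (κ.real {0}ᶜ ^ A.card) ^ (Fintype.card ι - s) * ψ s), Finset.card_univ]
  simp [nsmul_eq_mul]

/-- The expected excess over a unit loss, on the event that nobody is reached from `A`: given that
event each of the `card ι` particles independently has a further chance to lose exactly one. -/
theorem exists_excess_bound [Nonempty ι] (hκ : Integrable (fun n : ℕ => (n : ℝ)) κ)
    {A : Finset ι} (hA : A.Nonempty) :
    ∃ H : (ι → ι → ℕ) → ℝ, Integrable H (lossMatrixLaw ι κ) ∧ (∀ c, 0 ≤ H c) ∧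
      ∫ c, H c ∂lossMatrixLaw ι κ = (∫ n, ((n - 1 : ℕ) : ℝ) ∂κ) *
        κ.real {n | 2 ≤ n} ^ (Fintype.card ι - 1) * (κ.real {0}ᶜ ^ (A.card - 1)) ^ Fintype.card ι ∧
      ∀ (y : ι → ℕ) (c : ι → ι → ℕ), leaders y = A → reached A c = ∅ →
        ((⨅ i, lossStep c y i : ℕ) : ℝ) ≤ ((⨅ i, y i : ℕ) : ℝ) + 1 + H c := by
  classical
  obtain ⟨j₀, hj₀⟩ := hA
  set i₀ : ι := Classical.arbitrary ι
  set e : ι → ℕ → ℝ := fun i n =>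
    if i = i₀ then ((n - 1 : ℕ) : ℝ) else Set.indicator {n : ℕ | 2 ≤ n} 1 n with he
  set g : ι → ι → ℕ → ℝ := fun i j n =>
    if j = j₀ then e i n else if j ∈ A then Set.indicator {0}ᶜ 1 n else 1 with hg
  have he0 : ∀ i n, 0 ≤ e i n := by
    intro i n
    simp only [he]
    split_ifs
    · positivity
    · exact Set.indicator_nonneg (fun _ _ => zero_le_one) _
  have hg0 : ∀ i j n, 0 ≤ g i j n := by
    intro i j n
    simp only [hg]
    split_ifs
    · exact he0 i n
    · exact Set.indicator_nonneg (fun _ _ => zero_le_one) _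
    · exact zero_le_one
  have hind : ∀ S : Set ℕ, Integrable (S.indicator (1 : ℕ → ℝ)) κ := fun S =>
    (integrable_const (1 : ℝ)).indicator MeasurableSet.of_discrete
  have hsub : Integrable (fun n : ℕ => ((n - 1 : ℕ) : ℝ)) κ := by
    refine hκ.mono' Measurable.of_discrete.aestronglyMeasurable (ae_of_all _ fun n => ?_)
    rw [Real.norm_of_nonneg (by positivity)]
    exact_mod_cast Nat.sub_le n 1
  have hei : ∀ i, Integrable (e i) κ := by
    intro i
    by_cases hi : i = i₀
    · simpa [he, hi] using hsub
    · simpa [he, hi] using hind _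
  have hgi : ∀ i j, Integrable (g i j) κ := by
    intro i j
    by_cases hj : j = j₀
    · simpa [hg, hj] using hei i
    · by_cases hjA : j ∈ A
      · simpa [hg, hj, hjA] using hind _
      · simp [hg, hj, hjA]
  refine ⟨fun c => ∏ i, ∏ j, g i j (c i j), ?_, ?_, ?_, ?_⟩
  · exact Integrable.fintype_prod (f := fun i (r : ι → ℕ) => ∏ j, g i j (r j))
      fun i => Integrable.fintype_prod (f := fun j n => g i j n) fun j => hgi i j
  · exact fun c => Finset.prod_nonneg fun i _ => Finset.prod_nonneg fun j _ => hg0 i j _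
  · have h1 : ∀ i, ∫ r : ι → ℕ, ∏ j, g i j (r j) ∂(Measure.pi fun _ => κ)
        = (∫ n, e i n ∂κ) * κ.real {0}ᶜ ^ (A.card - 1) := by
      intro i
      rw [integral_fintype_prod_eq_prod, ← Finset.mul_prod_erase _ _ (Finset.mem_univ j₀)]
      congr 1
      · simp [hg]
      · have h2 : ∀ j ∈ Finset.univ.erase j₀, ∫ n, g i j n ∂κ
            = if j ∈ A.erase j₀ then κ.real {0}ᶜ else 1 := by
          intro j hj
          have hj' := Finset.ne_of_mem_erase hj
          by_cases hjA : j ∈ A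
          · simp [hg, hj', hjA, integral_indicator_one]
          · simp [hg, hj', hjA]
        rw [Finset.prod_congr rfl h2, Finset.prod_ite_mem, Finset.prod_const,
          Finset.inter_eq_right.2 (Finset.erase_subset_erase _ (Finset.subset_univ _)),
          Finset.card_erase_of_mem hj₀]
    have h3 : ∏ i, ∫ n, e i n ∂κ
        = (∫ n, ((n - 1 : ℕ) : ℝ) ∂κ) * κ.real {n | 2 ≤ n} ^ (Fintype.card ι - 1) := by
      rw [← Finset.mul_prod_erase _ _ (Finset.mem_univ i₀)]
      congr 1
      · simp [he]
      · rw [Finset.prod_congr rfl (g := fun _ => κ.real {n | 2 ≤ n}), Finset.prod_const,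
          Finset.card_erase_of_mem (Finset.mem_univ _), Finset.card_univ]
        intro i hi
        simp [he, Finset.ne_of_mem_erase hi, integral_indicator_one]
    rw [lossMatrixLaw, integral_fintype_prod_eq_prod (fun i (r : ι → ℕ) => ∏ j, g i j (r j)),
      Finset.prod_congr rfl fun i _ => h1 i, Finset.prod_mul_distrib, h3, Finset.prod_const,
      Finset.card_univ]
  · intro y c hy hc
    have hne : ∀ i, ∀ j ∈ A, c i j ≠ 0 := by
      intro i j hj h0
      have : i ∈ reached A c := mem_reached.2 ⟨j, hj, h0⟩
      simp [hc] at this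
    have hle : ∀ i, ⨅ i, lossStep c y i ≤ (⨅ i, y i) + c i j₀ := by
      intro i
      have h := (ciInf_le' (lossStep c y) i).trans (lossStep_le c y i j₀)
      rwa [mem_leaders.1 (hy ▸ hj₀ : j₀ ∈ leaders y)] at h
    have hH : ∏ i, ∏ j, g i j (c i j) = ∏ i, e i (c i j₀) := by
      refine Finset.prod_congr rfl fun i _ => ?_
      rw [← Finset.mul_prod_erase _ _ (Finset.mem_univ j₀), Finset.prod_eq_one, mul_one]
      · simp [hg]
      · intro j hj
        have hj' := Finset.ne_of_mem_erase hj
        by_cases hjA : j ∈ A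
        · simp [hg, hj', hjA, hne i j hjA]
        · simp [hg, hj', hjA]
    beta_reduce
    rw [hH]
    by_cases hex : ∃ i, c i j₀ = 1
    · -- Someone loses exactly one: there is no excess.
      obtain ⟨i, hi⟩ := hex
      have h1 := hle i
      rw [hi] at h1
      have h2 : (0 : ℝ) ≤ ∏ i, e i (c i j₀) := Finset.prod_nonneg fun i _ => he0 i _
      have h3 : ((⨅ i, lossStep c y i : ℕ) : ℝ) ≤ ((⨅ i, y i : ℕ) : ℝ) + 1 := by
        exact_mod_cast h1
      linarith
    · push Not at hex
      have h1 : ∏ i, e i (c i j₀) = ((c i₀ j₀ - 1 : ℕ) : ℝ) := by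
        rw [← Finset.mul_prod_erase _ _ (Finset.mem_univ i₀), Finset.prod_eq_one, mul_one]
        · simp [he]
        · intro i hi
          have h2 : 2 ≤ c i j₀ := by
            have := hne i j₀ hj₀
            have := hex i
            lia
          simp [he, Finset.ne_of_mem_erase hi, h2]
      rw [h1]
      have h2 := hle i₀
      have h3 : c i₀ j₀ = 1 + (c i₀ j₀ - 1) := by
        have := hne i₀ j₀ hj₀
        lia
      rw [h3, ← add_assoc] at h2
      exact_mod_cast h2

/-- One step raises the leader's deficit, corrected by a small function `φ` of the number of
leaders, by at most the right-hand side: a loss event costs `1 + η` and the excess. -/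
theorem integral_lossStep_le [Nonempty ι] (hκ : Integrable (fun n : ℕ => (n : ℝ)) κ)
    {φ : ℕ → ℝ} {η : ℝ} (hφ0 : ∀ s, 0 ≤ φ s) (hφη : ∀ s, φ s ≤ η) (y : ι → ℕ) :
    ∫ c, ((⨅ i, lossStep c y i : ℕ) : ℝ) + φ (leaders (lossStep c y)).card ∂lossMatrixLaw ι κ ≤
      ((⨅ i, y i : ℕ) : ℝ) +
      ∑ s ∈ Finset.range (Fintype.card ι + 1), (Fintype.card ι).choose s *
        ((1 - κ.real {0}ᶜ ^ (leaders y).card) ^ s *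
          (κ.real {0}ᶜ ^ (leaders y).card) ^ (Fintype.card ι - s) *
          if s = 0 then 1 + η else φ s) +
      (∫ n, ((n - 1 : ℕ) : ℝ) ∂κ) * κ.real {n | 2 ≤ n} ^ (Fintype.card ι - 1) *
        (κ.real {0}ᶜ ^ ((leaders y).card - 1)) ^ Fintype.card ι := by
  obtain ⟨H, hHi, hH0, hHint, hH⟩ := exists_excess_bound hκ (leaders_nonempty y)
  set ψ : ℕ → ℝ := fun s => if s = 0 then 1 + η else φ s with hψ
  have hη : 0 ≤ η := (hφ0 0).trans (hφη 0)
  have hψi : Integrable (fun c => ψ (reached (leaders y) c).card) (lossMatrixLaw ι κ) := by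
    refine Integrable.of_bound Measurable.of_discrete.aestronglyMeasurable (1 + η)
      (ae_of_all _ fun c => ?_)
    simp only [hψ, Real.norm_eq_abs]
    split_ifs
    · rw [abs_of_nonneg (by linarith)]
    · rw [abs_of_nonneg (hφ0 _)]
      linarith [hφη (reached (leaders y) c).card]
  rw [← hHint, ← integral_card_reached (leaders y) ψ]
  have hconst : Integrable (fun _ : ι → ι → ℕ => ((⨅ i, y i : ℕ) : ℝ)) (lossMatrixLaw ι κ) :=
    integrable_const _
  have h := integral_mono (integrable_iInf_lossStep_add (B := η)
    (φ := fun y => φ (leaders y).card) hκ (fun y => by rw [abs_of_nonneg (hφ0 _)]; exact hφη _) y)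
    ((hconst.add hψi).add hHi) fun c => ?_
  · refine h.trans_eq ?_
    rw [integral_add' (hconst.add hψi) hHi, integral_add' hconst hψi]
    simp
  · simp only [Pi.add_apply]
    rcases (reached (leaders y) c).eq_empty_or_nonempty with he | he
    · rw [he]
      have h1 := hH y c rfl he
      have h2 := hφη (leaders (lossStep c y)).card
      simp only [hψ, Finset.card_empty, if_true]
      linarith
    · rw [iInf_lossStep_of_reached_nonempty he, leaders_lossStep_of_reached_nonempty he]
      simp only [hψ, he.card_pos.ne', if_false]
      linarith [hH0 c]

/-- One step raises the leader's deficit plus `x ^ #leaders` by at least the right-hand side. -/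
theorem le_integral_lossStep [Nonempty ι] (hκ : Integrable (fun n : ℕ => (n : ℝ)) κ)
    {x : ℝ} (hx0 : 0 ≤ x) (hx1 : x ≤ 1) (y : ι → ℕ) :
    ((⨅ i, y i : ℕ) : ℝ) + (κ.real {0}ᶜ ^ (leaders y).card +
        (1 - κ.real {0}ᶜ ^ (leaders y).card) * x) ^ Fintype.card ι ≤
      ∫ c, ((⨅ i, lossStep c y i : ℕ) : ℝ) + x ^ (leaders (lossStep c y)).card
        ∂lossMatrixLaw ι κ := by
  have hψi : Integrable (fun c => x ^ (reached (leaders y) c).card) (lossMatrixLaw ι κ) :=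
    Integrable.of_bound Measurable.of_discrete.aestronglyMeasurable 1
      (ae_of_all _ fun c => by
        rw [Real.norm_of_nonneg (by positivity)]
        exact pow_le_one₀ hx0 hx1)
  have hconst : Integrable (fun _ : ι → ι → ℕ => ((⨅ i, y i : ℕ) : ℝ)) (lossMatrixLaw ι κ) :=
    integrable_const _
  have h := integral_mono (hconst.add hψi) (integrable_iInf_lossStep_add (B := 1)
    (φ := fun y => x ^ (leaders y).card) hκ
    (fun y => by rw [abs_of_nonneg (by positivity)]; exact pow_le_one₀ hx0 hx1) y) fun c => ?_
  · refine Eq.trans_le ?_ h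
    rw [integral_add' hconst hψi, integral_card_reached (leaders y) fun s => x ^ s, add_comm
      (κ.real {0}ᶜ ^ (leaders y).card), add_pow]
    simp only [integral_const, probReal_univ, one_smul, mul_pow]
    congr 1
    refine Finset.sum_congr rfl fun s _ => ?_
    ring
  · simp only [Pi.add_apply]
    rcases (reached (leaders y) c).eq_empty_or_nonempty with he | he
    · have h1 : (((⨅ i, y i) + 1 : ℕ) : ℝ) ≤ ((⨅ i, lossStep c y i : ℕ) : ℝ) := by
        exact_mod_cast iInf_add_one_le_of_reached_eq_empty he
      have h2 : 0 ≤ x ^ (leaders (lossStep c y)).card := by positivity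
      rw [he]
      push_cast at h1
      simp only [Finset.card_empty, pow_zero]
      linarith
    · rw [iInf_lossStep_of_reached_nonempty he, leaders_lossStep_of_reached_nonempty he]

end OneStep

/-! ### Binomial estimates and the two corrections -/

section BinomialEstimates

theorem add_pow_sub_pow_ge {a b : ℝ} (ha : 1 ≤ a) (hb : 0 ≤ b) (n : ℕ) :
    (1 + b) ^ n - 1 ≤ (a + b) ^ n - a ^ n := by
  induction n with
  | zero => simp
  | succ n ih =>
    have h1 : 0 ≤ (1 + b) ^ n - 1 := sub_nonneg.2 (one_le_pow₀ (by linarith))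
    have h2 : (1 + b) * ((1 + b) ^ n - 1) ≤ (a + b) * ((a + b) ^ n - a ^ n) :=
      mul_le_mul (by linarith) ih h1 (by linarith)
    have h3 : b ≤ b * a ^ n := le_mul_of_one_le_right hb (one_le_pow₀ ha)
    have e1 : (1 + b) ^ (n + 1) - 1 = (1 + b) * ((1 + b) ^ n - 1) + b := by ring
    have e2 : (a + b) ^ (n + 1) - a ^ (n + 1) = (a + b) * ((a + b) ^ n - a ^ n) + b * a ^ n := by
      ring
    rw [e1, e2]
    linarith

/-- With `x = q ^ N`, the function `z ↦ x ^ z` of the number `z` of leaders gains at least about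
`2 ^ N * q ^ (N ^ 2)` in one step, whatever `z` is. -/
theorem le_binomial_generating {q : ℝ} (hq0 : 0 < q) (hq1 : q < 1) {N z : ℕ} (hz : 1 ≤ z)
    (hzN : z ≤ N) (hN : 2 ≤ N * (1 - q)) :
    q ^ (N ^ 2) * 2 ^ N * (1 - N * q ^ N - (1 / 2) ^ N) + (q ^ N) ^ z ≤
      (q ^ z + (1 - q ^ z) * q ^ N) ^ N := by
  set a : ℝ := (q ^ (N - z))⁻¹ with ha
  set b : ℝ := 1 - q ^ z with hb
  have hqz : q ^ z = q ^ N * a := by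
    rw [ha, eq_mul_inv_iff_mul_eq₀ (by positivity), ← pow_add]
    congr 1
    lia
  have ha1 : 1 ≤ a := (one_le_inv₀ (by positivity)).2 (pow_le_one₀ hq0.le hq1.le)
  have hb1 : 1 - q ≤ b := sub_le_sub_left (pow_le_of_le_one hq0.le hq1.le (by lia)) 1
  have hqN : q ^ N ≤ 1 := pow_le_one₀ hq0.le hq1.le
  have hqN0 : 0 < q ^ N := by positivity
  have key : 2 ^ N * (1 - N * q ^ N - (1 / 2) ^ N) ≤ (a + b) ^ N - a ^ N := by
    rcases le_or_gt 2 a with h2 | h2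
    · -- Few leaders: the linear term of the binomial expansion suffices.
      have h3 : a ^ N + N * a ^ (N - 1) * b ≤ (a + b) ^ N := by
        have h4 := one_add_mul_le_pow (a := b / a)
          (by have : 0 ≤ b / a := div_nonneg (by linarith) (by linarith)
              linarith) N
        have h5 : a + b = a * (1 + b / a) := by field_simp
        have h6 : a ^ N = a * a ^ (N - 1) := by
          rw [← pow_succ']
          congr 1
          lia
        calc a ^ N + N * a ^ (N - 1) * b = a ^ N * (1 + N * (b / a)) := by
              rw [h6]; field_simp
          _ ≤ a ^ N * (1 + b / a) ^ N := by gcongr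
          _ = (a + b) ^ N := by rw [h5, mul_pow]
      have h4 : (2 : ℝ) ^ N ≤ N * a ^ (N - 1) * b := by
        have h6 : (2 : ℝ) ^ N = 2 * 2 ^ (N - 1) := by
          rw [← pow_succ']
          congr 1
          lia
        calc (2 : ℝ) ^ N = 2 * 2 ^ (N - 1) := h6
          _ ≤ (N * b) * a ^ (N - 1) := by
              have h8 : 2 ≤ N * b := hN.trans (by gcongr)
              exact mul_le_mul h8 (pow_le_pow_left₀ (by norm_num) h2 _) (by positivity)
                (by linarith)
          _ = N * a ^ (N - 1) * b := by ring
      have h7 : (2 : ℝ) ^ N * (1 - N * q ^ N - (1 / 2) ^ N) ≤ 2 ^ N := by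
        refine mul_le_of_le_one_right (by positivity) ?_
        have : 0 ≤ (N : ℝ) * q ^ N := by positivity
        have : 0 ≤ ((1 : ℝ) / 2) ^ N := by positivity
        linarith
      linarith
    · have h3 := add_pow_sub_pow_ge ha1 (by linarith : 0 ≤ b) N
      refine le_trans ?_ h3
      have hb2 : 2 * (1 - q ^ N) ≤ 1 + b := by
        rw [hb, hqz]
        nlinarith
      have h4 : (2 * (1 - q ^ N)) ^ N ≤ (1 + b) ^ N :=
        pow_le_pow_left₀ (by linarith) hb2 N
      have h5 := one_add_mul_le_pow (a := -q ^ N) (by linarith) N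
      have h6 : (2 : ℝ) ^ N * (1 + N * -q ^ N) ≤ 2 ^ N * (1 + -q ^ N) ^ N := by gcongr
      have h7 : (2 : ℝ) ^ N * (1 / 2) ^ N = 1 := by
        rw [← mul_pow]; norm_num
      rw [mul_pow, sub_eq_add_neg (1 : ℝ) (q ^ N)] at h4
      nlinarith
  have e1 : q ^ z + (1 - q ^ z) * q ^ N = q ^ N * (a + b) := by rw [hqz, hb, hqz]; ring
  have e2 : (q ^ N) ^ z = (q ^ N) ^ N * a ^ N := by
    rw [← mul_pow, ← hqz, ← pow_mul, ← pow_mul, mul_comm]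
  have e3 : q ^ (N ^ 2) = (q ^ N) ^ N := by rw [← pow_mul, sq]
  rw [e1, e2, e3, mul_pow]
  have : 0 ≤ (q ^ N) ^ N := by positivity
  nlinarith

theorem tendsto_sqrt_atTop : Tendsto Nat.sqrt atTop atTop :=
  tendsto_atTop_atTop.2 fun b => ⟨b * b, fun _ ha => Nat.le_sqrt.2 ha⟩

theorem cast_add_one_le_sqrt (N : ℕ) : (N : ℝ) + 1 ≤ ((Nat.sqrt N : ℝ) + 1) ^ 2 := by
  have h := Nat.lt_succ_sqrt' N
  have : N + 1 ≤ (Nat.sqrt N + 1) ^ 2 := h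
  exact_mod_cast this

theorem tendsto_add_one_sq_mul_pow {x : ℝ} (hx0 : 0 < x) (hx1 : x < 1) :
    Tendsto (fun M : ℕ => ((M : ℝ) + 1) ^ 2 * x ^ M) atTop (𝓝 0) := by
  have h := (tendsto_add_atTop_iff_nat 1).2
    (tendsto_pow_const_mul_const_pow_of_abs_lt_one 2 (abs_lt.2 ⟨by linarith, hx1⟩))
  have h2 := h.mul_const x⁻¹
  rw [zero_mul] at h2
  refine h2.congr fun M => ?_
  push_cast
  rw [pow_succ x]
  field_simp

/-- Powers with exponent `√N` of polynomials in `N` are negligible against exponentials. -/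
theorem tendsto_pow_mul_pow_sqrt {x C : ℝ} (hx0 : 0 < x) (hx1 : x < 1) (hC : 0 ≤ C) :
    Tendsto (fun N : ℕ => x ^ N * (C * (N + 1)) ^ Nat.sqrt N) atTop (𝓝 0) := by
  have h1 : Tendsto (fun M : ℕ => C * (((M : ℝ) + 1) ^ 2 * x ^ M)) atTop (𝓝 0) := by
    simpa using (tendsto_add_one_sq_mul_pow hx0 hx1).const_mul C
  have h1' := h1.comp tendsto_sqrt_atTop
  refine squeeze_zero' (Eventually.of_forall fun N => by positivity) ?_ h1'
  filter_upwards [h1'.eventually_lt_const one_pos, tendsto_sqrt_atTop.eventually_ge_atTop 1]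
    with N hN hM
  simp only [Function.comp] at hN ⊢
  set M := Nat.sqrt N with hMdef
  have hM2 : M * M ≤ N := Nat.sqrt_le N
  calc x ^ N * (C * (N + 1)) ^ M ≤ x ^ (M * M) * (C * (M + 1) ^ 2) ^ M := by
        refine mul_le_mul (pow_le_pow_of_le_one hx0.le hx1.le hM2) ?_ (by positivity)
          (by positivity)
        have := cast_add_one_le_sqrt N
        gcongr
    _ = (C * (((M : ℝ) + 1) ^ 2 * x ^ M)) ^ M := by rw [pow_mul, ← mul_pow]; ring
    _ ≤ C * (((M : ℝ) + 1) ^ 2 * x ^ M) := pow_le_of_le_one (by positivity) hN.le (by lia)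

theorem sum_choose_lt_le {N : ℕ} (hN : 1 ≤ N) (M : ℕ) :
    ∑ r ∈ Finset.range M, (N.choose r : ℝ) ≤ ((N : ℝ) + 1) ^ M := by
  induction M with
  | zero => simp
  | succ M ih =>
    rw [Finset.sum_range_succ]
    have h1 : (N.choose M : ℝ) ≤ N * ((N : ℝ) + 1) ^ M := by
      have h2 : N.choose M ≤ N * (N + 1) ^ M :=
        (Nat.choose_le_pow N M).trans ((Nat.pow_le_pow_left N.le_succ M).trans
          (Nat.le_mul_of_pos_left _ hN))
      exact_mod_cast h2
    rw [pow_succ]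
    linarith

/-- Eventual smallness of all the error terms below, with cutoff `M = √N`. -/
theorem eventually_error_bounds {q : ℝ} (hq0 : 0 < q) (hq1 : q < 1) {θ : ℝ} (hθ : 0 < θ) :
    ∀ᶠ N : ℕ in atTop,
      4 * (1 + q) ^ N * ((N : ℝ) + 1) ^ Nat.sqrt N ≤ θ * 2 ^ N ∧
      q ^ (N - Nat.sqrt N) * ((N : ℝ) + 1) ^ Nat.sqrt N ≤ 1 / 2 ∧
      (1 + q ^ Nat.sqrt N) ^ N - 1 ≤ θ / 4 ∧
      4 * (1 + q) ^ N * q ^ (Nat.sqrt N * (N - Nat.sqrt N)) * ((N : ℝ) + 1) ^ Nat.sqrt N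
        ≤ θ / 2 := by
  have t1 := tendsto_pow_mul_pow_sqrt (x := (1 + q) / 2) (C := 1) (by linarith) (by linarith)
    zero_le_one
  have t2 := tendsto_pow_mul_pow_sqrt (x := q) (C := q⁻¹) hq0 hq1 (by positivity)
  have t3 : Tendsto (fun N : ℕ => Real.exp (((Nat.sqrt N : ℝ) + 1) ^ 2 * q ^ Nat.sqrt N)) atTop
      (𝓝 1) := by
    have := (Real.continuous_exp.tendsto 0).comp
      ((tendsto_add_one_sq_mul_pow hq0 hq1).comp tendsto_sqrt_atTop)
    rwa [Real.exp_zero] at this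
  have t4 := tendsto_pow_mul_pow_sqrt (x := 1 / 2) (C := 4) (by norm_num) (by norm_num)
    (by norm_num)
  have t5 := (tendsto_pow_atTop_nhds_zero_of_lt_one hq0.le hq1).comp tendsto_sqrt_atTop
  filter_upwards [t1.eventually_lt_const (show 0 < θ / 4 by positivity),
    t2.eventually_lt_const (show (0 : ℝ) < 1 / 2 by norm_num),
    t3.eventually_lt_const (show 1 < 1 + θ / 4 by linarith),
    t4.eventually_lt_const (show 0 < θ / 8 by positivity),
    t5.eventually_lt_const (show (0 : ℝ) < 1 / 4 by norm_num)] with N h1 h2 h3 h4 h5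
  simp only [Function.comp] at h5
  set M := Nat.sqrt N with hM
  have hMN : M ≤ N := Nat.sqrt_le_self N
  refine ⟨?_, ?_, ?_, ?_⟩
  · rw [div_pow, one_mul, div_mul_eq_mul_div, div_lt_iff₀ (by positivity)] at h1
    linarith
  · refine le_trans (le_of_eq ?_) h2.le
    rw [mul_pow, inv_pow, ← mul_assoc, ← pow_sub₀ q hq0.ne' hMN]
  · have h6 : (1 + q ^ M) ^ N ≤ Real.exp (((M : ℝ) + 1) ^ 2 * q ^ M) := by
      calc (1 + q ^ M) ^ N ≤ Real.exp (q ^ M) ^ N := by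
            gcongr
            linarith [Real.add_one_le_exp (q ^ M)]
        _ = Real.exp (N * q ^ M) := (Real.exp_nat_mul _ _).symm
        _ ≤ _ := by
            gcongr
            linarith [cast_add_one_le_sqrt N]
    linarith
  · have h6 : q ^ (M * (N - M)) ≤ (1 / 4) ^ (N - M) := by
      rw [pow_mul]
      exact pow_le_pow_left₀ (by positivity) h5.le _
    have h7 : (1 + q) ^ N ≤ 2 ^ N := pow_le_pow_left₀ (by linarith) (by linarith) _
    calc 4 * (1 + q) ^ N * q ^ (M * (N - M)) * ((N : ℝ) + 1) ^ M
        ≤ 4 * 2 ^ N * (1 / 4) ^ (N - M) * ((N : ℝ) + 1) ^ M := by gcongr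
      _ = 4 * ((1 / 2) ^ N * (4 * ((N : ℝ) + 1)) ^ M) := by
          rw [mul_pow, pow_sub₀ _ (by norm_num) hMN]
          have : ((1 : ℝ) / 4) ^ N = (1 / 2) ^ N * (1 / 2) ^ N := by
            rw [← mul_pow]; norm_num
          rw [this]
          have h8 : (2 : ℝ) ^ N * (1 / 2) ^ N = 1 := by rw [← mul_pow]; norm_num
          have h9 : (((1 : ℝ) / 4) ^ M)⁻¹ = 4 ^ M := by
            rw [← inv_pow]; norm_num
          rw [h9]
          linear_combination 4 * (1 / 2) ^ N * 4 ^ M * ((N : ℝ) + 1) ^ M * h8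
      _ ≤ θ / 2 := by linarith

/-- The weight attached to a configuration with `N - m` leaders, relative to `q ^ ((N - m) N)`.
It is nearly `1`, except for nearly full fronts, where it is inflated. -/
noncomputable def frontWeight (q θ : ℝ) (N m : ℕ) : ℝ :=
  if m < Nat.sqrt N then 4 * (1 + q) ^ N else 1 + θ

theorem frontWeight_nonneg {q θ : ℝ} (hq0 : 0 < q) (hθ : 0 < θ) (N m : ℕ) :
    0 ≤ frontWeight q θ N m := by
  unfold frontWeight
  split_ifs <;> positivity

/-- The supersolution inequality for `frontWeight`. -/
theorem frontWeight_supersolution {q θ : ℝ} (hq0 : 0 < q) (hq1 : q < 1) (hθ : 0 < θ)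
    (hθ1 : θ ≤ 1) {N : ℕ} (hN : 1 ≤ N)
    (H1 : 4 * (1 + q) ^ N * ((N : ℝ) + 1) ^ Nat.sqrt N ≤ θ * 2 ^ N)
    (H2 : q ^ (N - Nat.sqrt N) * ((N : ℝ) + 1) ^ Nat.sqrt N ≤ 1 / 2)
    (H3 : (1 + q ^ Nat.sqrt N) ^ N - 1 ≤ θ / 4)
    (H4 : 4 * (1 + q) ^ N * q ^ (Nat.sqrt N * (N - Nat.sqrt N)) * ((N : ℝ) + 1) ^ Nat.sqrt N
        ≤ θ / 2) (m : ℕ) :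
    1 + ∑ s ∈ Finset.Icc 1 N, N.choose s * ((q ^ m) ^ s * frontWeight q θ N (N - s)) ≤
      frontWeight q θ N m + (1 + 2 * θ) * (2 ^ N * (q ^ m) ^ N) := by
  set M := Nat.sqrt N with hM
  set b : ℝ := 4 * (1 + q) ^ N with hb
  have hb0 : 0 < b := by positivity
  have hMN : M ≤ N := Nat.sqrt_le_self N
  have hM1 : 1 ≤ M := Nat.le_sqrt.2 (by simpa using hN)
  have hqm0 : 0 < q ^ m := by positivity
  have hqm1 : q ^ m ≤ 1 := pow_le_one₀ hq0.le hq1.le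
  have hsplit : 1 + ∑ s ∈ Finset.Icc 1 N, N.choose s * ((q ^ m) ^ s * frontWeight q θ N (N - s))
      ≤ 1 + (1 + θ) * ((1 + q ^ m) ^ N - 1)
        + b * (q ^ m) ^ (N - M) * ((N : ℝ) + 1) ^ M := by
    have e1 : (1 + q ^ m) ^ N - 1 = ∑ s ∈ Finset.Icc 1 N, N.choose s * (q ^ m) ^ s := by
      rw [add_comm, add_pow, Finset.range_eq_Ico, Finset.sum_eq_sum_Ico_succ_bot (by lia)]
      simp only [pow_zero, one_pow, mul_one, Nat.choose_zero_right, Nat.cast_one,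
        add_sub_cancel_left]
      exact Finset.sum_congr rfl fun s _ => mul_comm _ _
    have e2 : ∑ s ∈ (Finset.Icc 1 N).filter (fun s => N - s < M), (N.choose s : ℝ)
        ≤ ((N : ℝ) + 1) ^ M := by
      refine le_trans ?_ (sum_choose_lt_le hN M)
      have hinj : Set.InjOn (fun s => N - s)
          ((Finset.Icc 1 N).filter (fun s => N - s < M) : Finset ℕ) := by
        intro s hs t ht hst
        simp only [Finset.coe_filter, Finset.mem_Icc, Set.mem_ofPred_eq] at hs ht hst
        lia
      rw [Finset.sum_congr rfl (g := fun s => (N.choose (N - s) : ℝ)),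
        ← Finset.sum_image (f := fun r => (N.choose r : ℝ)) hinj]
      · refine Finset.sum_le_sum_of_subset_of_nonneg ?_ fun _ _ _ => by positivity
        intro r hr
        simp only [Finset.mem_image, Finset.mem_filter] at hr
        obtain ⟨s, hs, rfl⟩ := hr
        exact Finset.mem_range.2 hs.2
      · intro s hs
        simp only [Finset.mem_filter, Finset.mem_Icc] at hs
        rw [Nat.choose_symm hs.1.2]
    have e3 : ∀ s ∈ Finset.Icc 1 N,
        N.choose s * ((q ^ m) ^ s * frontWeight q θ N (N - s)) ≤
          (1 + θ) * (N.choose s * (q ^ m) ^ s) +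
            if N - s < M then b * (q ^ m) ^ (N - M) * N.choose s else 0 := by
      intro s hs
      rw [Finset.mem_Icc] at hs
      by_cases h : N - s < M
      · have h1 : (q ^ m) ^ s ≤ (q ^ m) ^ (N - M) :=
          pow_le_pow_of_le_one hqm0.le hqm1 (by lia)
        have h2 : (0 : ℝ) ≤ (1 + θ) * (N.choose s * (q ^ m) ^ s) := by positivity
        have h3 : (N.choose s : ℝ) * ((q ^ m) ^ s * b) ≤ N.choose s * ((q ^ m) ^ (N - M) * b) := by
          gcongr
        simp only [frontWeight, ← hM, h, if_true, ← hb]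
        linarith
      · simp only [frontWeight, ← hM, h, if_false]
        linarith
    have e4 := Finset.sum_le_sum e3
    rw [Finset.sum_add_distrib, ← Finset.mul_sum, ← e1, ← Finset.sum_filter,
      ← Finset.mul_sum] at e4
    have e5 := mul_le_mul_of_nonneg_left e2 (show 0 ≤ b * (q ^ m) ^ (N - M) by positivity)
    linarith
  refine hsplit.trans ?_
  have hP0 : (0 : ℝ) ≤ ((N : ℝ) + 1) ^ M := by positivity
  have hR0 : 0 ≤ (1 + 2 * θ) * (2 ^ N * (q ^ m) ^ N) := by positivity
  rcases Nat.eq_zero_or_pos m with rfl | hm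
  · have h1 : 1 ≤ (1 + q) ^ N := one_le_pow₀ (by linarith)
    have hw : frontWeight q θ N 0 = b := by
      simp only [frontWeight, ← hM, ← hb]
      rw [if_pos (by lia)]
    rw [hw]
    norm_num
    linarith
  · rcases lt_or_ge m M with hmM | hmM
    · have hw : frontWeight q θ N m = b := by simp [frontWeight, ← hM, hmM, hb]
      have h1 : (1 + q ^ m) ^ N ≤ (1 + q) ^ N := by
        gcongr
        exact pow_le_of_le_one hq0.le hq1.le (by lia)
      have h2 : (q ^ m) ^ (N - M) ≤ q ^ (N - M) := by
        gcongr
        exact pow_le_of_le_one hq0.le hq1.le (by lia)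
      have h3 : b * (q ^ m) ^ (N - M) * ((N : ℝ) + 1) ^ M ≤ b * (1 / 2) := by
        rw [mul_assoc]
        refine mul_le_mul_of_nonneg_left (le_trans ?_ H2) hb0.le
        gcongr
      have h4 : (1 + θ) * ((1 + q ^ m) ^ N - 1) ≤ 2 * ((1 + q) ^ N - 1) := by
        refine mul_le_mul (by linarith) (by linarith) ?_ (by norm_num)
        exact sub_nonneg.2 (one_le_pow₀ (by linarith))
      rw [hw]
      linarith
    · have hw : frontWeight q θ N m = 1 + θ := by
        simp only [frontWeight, ← hM]
        rw [if_neg (by lia)]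
      have hqq : q ^ m ≤ q ^ M := pow_le_pow_of_le_one hq0.le hq1.le hmM
      have h1 : (1 + q ^ m) ^ N ≤ (1 + q ^ M) ^ N := by gcongr
      have h2 : b * (q ^ m) ^ (N - M) * ((N : ℝ) + 1) ^ M ≤ θ / 2 := by
        refine le_trans ?_ H4
        rw [pow_mul q M]
        gcongr
      have h4 : (1 + θ) * ((1 + q ^ m) ^ N - 1) ≤ 2 * (θ / 4) := by
        refine mul_le_mul (by linarith) (by linarith) ?_ (by norm_num)
        exact sub_nonneg.2 (one_le_pow₀ (by linarith))
      rw [hw]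
      linarith

/-- The correction used for the upper bound on the rate of loss: a small function of the number of
leaders whose one-step drift, loss events included, is at most `(1 + δ) 2 ^ N q ^ (N ^ 2)`. -/
theorem eventually_exists_supersolution {q r w δ : ℝ} (hq0 : 0 < q) (hq1 : q < 1) (hr0 : 0 ≤ r)
    (hrq : r < q) (hδ : 0 < δ) :
    ∀ᶠ N : ℕ in atTop, ∃ (φ : ℕ → ℝ) (η : ℝ), (∀ s, 0 ≤ φ s) ∧ (∀ s, φ s ≤ η) ∧
      ∀ z, 1 ≤ z → z ≤ N →
        ∑ s ∈ Finset.range (N + 1), N.choose s *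
          ((1 - q ^ z) ^ s * (q ^ z) ^ (N - s) * if s = 0 then 1 + η else φ s) +
          w * r ^ (N - 1) * (q ^ (z - 1)) ^ N ≤
        φ z + (1 + δ) * (q ^ (N ^ 2) * 2 ^ N) := by
  obtain ⟨θ, hθ, hθ2, hθδ⟩ : ∃ θ : ℝ, 0 < θ ∧ θ ≤ 1 / 2 ∧ 6 * θ ≤ δ :=
    ⟨min (δ / 6) (1 / 2), by positivity, min_le_right _ _, by
      have := min_le_left (δ / 6) (1 / 2)
      linarith⟩
  have t1 : Tendsto (fun N : ℕ => w / q * (r / q) ^ (N - 1)) atTop (𝓝 0) := by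
    have := ((tendsto_pow_atTop_nhds_zero_of_lt_one (by positivity)
      ((div_lt_one hq0).2 hrq)).comp (tendsto_sub_atTop_nat 1)).const_mul (w / q)
    simpa using this
  have t2 : Tendsto (fun N : ℕ => (1 + 2 * θ) * (1 + θ) * q ^ N) atTop (𝓝 0) := by
    simpa using (tendsto_pow_atTop_nhds_zero_of_lt_one hq0.le hq1).const_mul
      ((1 + 2 * θ) * (1 + θ))
  filter_upwards [eventually_error_bounds hq0 hq1 hθ, eventually_ge_atTop 1,
    t1.eventually_lt_const hθ, t2.eventually_lt_const hθ] with N ⟨H1, H2, H3, H4⟩ hN H5 H6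
  set M := Nat.sqrt N with hM
  have hMN : M ≤ N := Nat.sqrt_le_self N
  have hM1 : 1 ≤ M := Nat.le_sqrt.2 (by simpa using hN)
  set φ : ℕ → ℝ := fun z =>
    if z = 0 then 0 else (1 + 2 * θ) * ((q ^ N) ^ z * frontWeight q θ N (N - z)) with hφ
  refine ⟨φ, θ, ?_, ?_, ?_⟩
  · intro s
    simp only [hφ]
    have := frontWeight_nonneg hq0 hθ N (N - s)
    split_ifs <;> positivity
  · intro s
    simp only [hφ]
    split_ifs with hs
    · exact hθ.le
    by_cases hsM : N - s < M
    · have h1 : (q ^ N) ^ s * (4 * (1 + q) ^ N) ≤ θ / 2 := by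
        refine le_trans ?_ H4
        have h2 : (q ^ N) ^ s ≤ q ^ (M * (N - M)) := by
          rw [← pow_mul]
          exact pow_le_pow_of_le_one hq0.le hq1.le (Nat.mul_le_mul hMN (by lia))
        have h3 : 1 ≤ ((N : ℝ) + 1) ^ M := one_le_pow₀ (by linarith [Nat.cast_nonneg (α := ℝ) N])
        calc (q ^ N) ^ s * (4 * (1 + q) ^ N) ≤ q ^ (M * (N - M)) * (4 * (1 + q) ^ N) := by gcongr
          _ = 4 * (1 + q) ^ N * q ^ (M * (N - M)) * 1 := by ring
          _ ≤ _ := by gcongr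
      rw [frontWeight, ← hM, if_pos hsM]
      nlinarith
    · rw [frontWeight, ← hM, if_neg hsM]
      have h1 : (q ^ N) ^ s ≤ q ^ N :=
        pow_le_of_le_one (by positivity) (pow_le_one₀ hq0.le hq1.le) hs
      calc (1 + 2 * θ) * ((q ^ N) ^ s * (1 + θ)) ≤ (1 + 2 * θ) * (q ^ N * (1 + θ)) := by gcongr
        _ ≤ θ := by linarith
  · intro z hz hzN
    obtain ⟨m, rfl⟩ : ∃ m, N = z + m := ⟨N - z, by lia⟩
    set N := z + m with hNdef
    have hsup := frontWeight_supersolution hq0 hq1 hθ (by linarith) hN H1 H2 H3 H4 m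
    have hX : q ^ (N ^ 2) = (q ^ z) ^ N * (q ^ m) ^ N := by
      rw [← mul_pow, ← pow_add, ← pow_mul, sq]
    have hφz : φ z = (1 + 2 * θ) * ((q ^ z) ^ N * frontWeight q θ N m) := by
      have : N - z = m := by lia
      simp only [hφ]
      rw [if_neg (by lia), this, ← pow_mul, ← pow_mul, mul_comm z]
    have hzero : w * r ^ (N - 1) * (q ^ (z - 1)) ^ N ≤ (q ^ z) ^ N * θ := by
      have h1 : q ^ z = q * q ^ (z - 1) := by rw [← pow_succ']; congr 1; lia
      have h2 : q ^ N = q * q ^ (N - 1) := by rw [← pow_succ']; congr 1; lia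
      have h3 : w * r ^ (N - 1) = q ^ N * (w / q * (r / q) ^ (N - 1)) := by
        rw [h2, div_pow]
        field_simp
      rw [h3, h1, mul_pow]
      have h4 : 0 ≤ q ^ N * (q ^ (z - 1)) ^ N := by positivity
      nlinarith
    have hterm : ∀ s ∈ Finset.Icc 1 N, N.choose s *
        ((1 - q ^ z) ^ s * (q ^ z) ^ (N - s) * if s = 0 then 1 + θ else φ s) ≤
        (1 + 2 * θ) * (q ^ z) ^ N * (N.choose s * ((q ^ m) ^ s * frontWeight q θ N (N - s))) := by
      intro s hs
      rw [Finset.mem_Icc] at hs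
      have hW := frontWeight_nonneg hq0 hθ N (N - s)
      have hqz : q ^ z ≤ 1 := pow_le_one₀ hq0.le hq1.le
      have h1 : (1 - q ^ z) ^ s ≤ 1 :=
        pow_le_one₀ (by linarith) (by linarith [show 0 < q ^ z by positivity])
      have h2 : (q ^ z) ^ (N - s) * (q ^ N) ^ s = (q ^ z) ^ N * (q ^ m) ^ s := by
        rw [hNdef, pow_add q z m, mul_pow, ← mul_assoc, ← pow_add, Nat.sub_add_cancel hs.2]
      rw [if_neg (by lia)]
      simp only [hφ]
      rw [if_neg (by lia)]
      calc N.choose s * ((1 - q ^ z) ^ s * (q ^ z) ^ (N - s) *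
            ((1 + 2 * θ) * ((q ^ N) ^ s * frontWeight q θ N (N - s))))
          ≤ N.choose s * (1 * (q ^ z) ^ (N - s) *
            ((1 + 2 * θ) * ((q ^ N) ^ s * frontWeight q θ N (N - s)))) := by gcongr
        _ = (1 + 2 * θ) * (((q ^ z) ^ (N - s) * (q ^ N) ^ s)) *
            (N.choose s * frontWeight q θ N (N - s)) := by ring
        _ = _ := by rw [h2]; ring
    have hsum : ∑ s ∈ Finset.range (N + 1), N.choose s *
        ((1 - q ^ z) ^ s * (q ^ z) ^ (N - s) * if s = 0 then 1 + θ else φ s) ≤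
        (q ^ z) ^ N * (1 + θ) + (1 + 2 * θ) * (q ^ z) ^ N *
          ∑ s ∈ Finset.Icc 1 N, N.choose s * ((q ^ m) ^ s * frontWeight q θ N (N - s)) := by
      rw [Finset.range_eq_Ico, Finset.sum_eq_sum_Ico_succ_bot (by lia), Finset.mul_sum]
      refine add_le_add (by simp) ?_
      exact Finset.sum_le_sum hterm
    have hA : 0 ≤ (1 + 2 * θ) * (q ^ z) ^ N := by positivity
    have h5 := mul_le_mul_of_nonneg_left hsup hA
    have h6 : (1 + 2 * θ) * (1 + 2 * θ) ≤ 1 + δ := by nlinarith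
    have h7 := mul_le_mul_of_nonneg_right h6
      (show 0 ≤ q ^ (N ^ 2) * 2 ^ N by positivity)
    rw [hφz]
    rw [hX] at h7 ⊢
    linarith

end BinomialEstimates

/-! ### Bounds on the rate of loss -/

section RateBounds

/-- A linear bound with a bounded error bounds the slope. -/
theorem le_of_forall_nat_mul_le_add {a b D : ℝ} (h : ∀ n : ℕ, 1 ≤ n → n * a ≤ n * b + D) :
    a ≤ b := by
  by_contra! hab
  obtain ⟨n, hn⟩ := exists_nat_gt (D / (a - b))
  have h1 := h (n + 1) (by lia)
  rw [div_lt_iff₀ (sub_pos.2 hab)] at hn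
  push_cast at h1
  nlinarith

variable {ι : Type*} [Fintype ι] [Nonempty ι] {κ : Measure ℕ} [IsProbabilityMeasure κ]

theorem lossRate_le (hκ : Integrable (fun n : ℕ => (n : ℝ)) κ) {l C : ℝ}
    (hl : ∀ n : ℕ, 1 ≤ n → n * l ≤ ∫ c, (minLoss c n : ℝ) ∂lossLaw ι κ + C)
    {φ : ℕ → ℝ} {η K : ℝ} (hφ0 : ∀ s, 0 ≤ φ s) (hφη : ∀ s, φ s ≤ η)
    (hK : ∀ z, 1 ≤ z → z ≤ Fintype.card ι →
      ∑ s ∈ Finset.range (Fintype.card ι + 1), (Fintype.card ι).choose s *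
        ((1 - κ.real {0}ᶜ ^ z) ^ s * (κ.real {0}ᶜ ^ z) ^ (Fintype.card ι - s) *
          if s = 0 then 1 + η else φ s) +
      (∫ n, ((n - 1 : ℕ) : ℝ) ∂κ) * κ.real {n | 2 ≤ n} ^ (Fintype.card ι - 1) *
        (κ.real {0}ᶜ ^ (z - 1)) ^ Fintype.card ι ≤ φ z + K) : l ≤ K := by
  have hB : ∀ y : ι → ℕ, |φ (leaders y).card| ≤ η := fun y => by
    rw [abs_of_nonneg (hφ0 _)]
    exact hφη _
  refine le_of_forall_nat_mul_le_add (D := φ (leaders (0 : ι → ℕ)).card + C) fun n hn => ?_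
  have h1 := integral_minLoss_add_le (K := K) hκ hB (fun y => by
    have h2 := integral_lossStep_le hκ hφ0 hφη y
    have h3 := hK _ (leaders_nonempty y).card_pos (Finset.card_le_univ _)
    linarith) n
  have h4 : ∫ c, (minLoss c n : ℝ) ∂lossLaw ι κ ≤
      ∫ c, (minLoss c n : ℝ) + φ (leaders (lossPath c 0 n)).card ∂lossLaw ι κ :=
    integral_mono (integrable_minLoss hκ n) (integrable_minLoss_add hκ hB n) fun c => by
      simpa using hφ0 _
  linarith [hl n hn]

theorem le_lossRate (hκ : Integrable (fun n : ℕ => (n : ℝ)) κ) {l : ℝ}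
    (hl : ∀ n : ℕ, 1 ≤ n → ∫ c, (minLoss c n : ℝ) ∂lossLaw ι κ ≤ n * l)
    {x K : ℝ} (hx0 : 0 ≤ x) (hx1 : x ≤ 1)
    (hK : ∀ z, 1 ≤ z → z ≤ Fintype.card ι →
      K + x ^ z ≤ (κ.real {0}ᶜ ^ z + (1 - κ.real {0}ᶜ ^ z) * x) ^ Fintype.card ι) : K ≤ l := by
  have hB : ∀ y : ι → ℕ, |x ^ (leaders y).card| ≤ 1 := fun y => by
    rw [abs_of_nonneg (by positivity)]
    exact pow_le_one₀ hx0 hx1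
  refine le_of_forall_nat_mul_le_add (D := 1) fun n hn => ?_
  have h1 := le_integral_minLoss_add (K := K) hκ hB (fun y => by
    have h2 := le_integral_lossStep hκ hx0 hx1 y
    have h3 := hK _ (leaders_nonempty y).card_pos (Finset.card_le_univ _)
    linarith) n
  have h4 : ∫ c, (minLoss c n : ℝ) + x ^ (leaders (lossPath c 0 n)).card ∂lossLaw ι κ ≤
      ∫ c, (minLoss c n : ℝ) + 1 ∂lossLaw ι κ :=
    integral_mono (integrable_minLoss_add hκ hB n)
      ((integrable_minLoss hκ n).add (integrable_const 1)) fun c => by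
      simpa using pow_le_one₀ hx0 hx1
  rw [integral_add (integrable_minLoss hκ n) (integrable_const 1)] at h4
  simp only [integral_const, probReal_univ, one_smul] at h4
  have h5 : 0 ≤ x ^ (leaders (0 : ι → ℕ)).card := by positivity
  linarith [hl n hn]

end RateBounds

/-! ### From jumps to losses -/

section Transfer

/-- The law of the loss `k - ξ` of a jump `ξ` with law `μ`, relative to the maximal jump `k`. -/
noncomputable def jumpLossLaw (k : ℤ) (μ : Measure ℤ) : Measure ℕ := μ.map fun l => (k - l).toNat

instance (k : ℤ) (μ : Measure ℤ) [IsProbabilityMeasure μ] :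
    IsProbabilityMeasure (jumpLossLaw k μ) :=
  Measure.isProbabilityMeasure_map Measurable.of_discrete.aemeasurable

variable {k : ℤ} {μ : Measure ℤ} [IsProbabilityMeasure μ]

theorem integrable_jumpLossLaw (hint : Integrable (fun l : ℤ => (l : ℝ)) μ) :
    Integrable (fun n : ℕ => (n : ℝ)) (jumpLossLaw k μ) := by
  rw [jumpLossLaw, integrable_map_measure Measurable.of_discrete.aestronglyMeasurable
    Measurable.of_discrete.aemeasurable]
  refine ((integrable_const (k : ℝ)).sub hint).norm.mono'
    Measurable.of_discrete.aestronglyMeasurable (ae_of_all _ fun l => ?_)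
  simp only [Function.comp, Pi.sub_apply]
  rw [Real.norm_of_nonneg (by positivity), Real.norm_eq_abs]
  have h : ((k - l).toNat : ℤ) ≤ |k - l| := by
    rw [Int.toNat_eq_max]
    exact max_le (le_abs_self _) (abs_nonneg _)
  exact_mod_cast h

theorem jumpLossLaw_real_compl_zero (hmax : μ (Set.Ioi k) = 0) :
    (jumpLossLaw k μ).real {0}ᶜ = 1 - μ.real {k} := by
  rw [jumpLossLaw, map_measureReal_apply Measurable.of_discrete MeasurableSet.of_discrete,
    ← probReal_compl_eq_one_sub MeasurableSet.of_discrete]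
  refine measureReal_congr ?_
  have hle : ∀ᵐ l ∂μ, l ≤ k := by
    rw [ae_iff]
    simpa [Set.Ioi] using hmax
  filter_upwards [hle] with l hl
  refine propext ?_
  change ((k - l).toNat ∈ ({0}ᶜ : Set ℕ)) ↔ l ∈ ({k}ᶜ : Set ℤ)
  simp only [Set.mem_compl_iff, Set.mem_singleton_iff]
  lia

theorem jumpLossLaw_real_two_le_lt (h : 0 < μ.real {k - 1}) :
    (jumpLossLaw k μ).real {n | 2 ≤ n} < (jumpLossLaw k μ).real {0}ᶜ := by
  have h1 : μ.real {k - 1} ≤ (jumpLossLaw k μ).real {1} := by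
    rw [jumpLossLaw, map_measureReal_apply Measurable.of_discrete MeasurableSet.of_discrete]
    refine measureReal_mono ?_
    rintro l rfl
    simp
  have h2 : ({0}ᶜ : Set ℕ) = {n | 2 ≤ n} ∪ {1} := by
    ext n
    simp only [Set.mem_compl_iff, Set.mem_singleton_iff, Set.mem_union, Set.mem_ofPred_eq]
    lia
  have h3 : Disjoint {n : ℕ | 2 ≤ n} {1} := by
    simp
  rw [h2, measureReal_union h3 MeasurableSet.of_discrete]
  linarith

variable {Ω : Type*} [MeasurableSpace Ω] {P : Measure Ω} {N : ℕ}
  {ξ : ℕ → Fin N → Fin N → Ω → ℤ}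

/-- The array of losses has the law of an independent sequence of independent matrices. -/
theorem IsIIDNoise.hasLaw_loss (hξ : IsIIDNoise P ξ μ) (k : ℤ) :
    HasLaw (fun ω t i j => (k - ξ t i j ω).toNat) (lossLaw (Fin N) (jumpLossLaw k μ)) P := by
  have hm : Measurable fun l : ℤ => (k - l).toNat := Measurable.of_discrete
  have hlaw : ∀ a : ℕ × Fin N × Fin N,
      HasLaw (fun ω => (k - ξ a.1 a.2.1 a.2.2 ω).toNat) (jumpLossLaw k μ) P := fun a =>
    HasLaw.comp ⟨hm.aemeasurable, rfl⟩ (hξ.hasLaw a.1 a.2.1 a.2.2)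
  have hind : iIndepFun (fun (a : ℕ × Fin N × Fin N) ω => (k - ξ a.1 a.2.1 a.2.2 ω).toNat) P :=
    hξ.indep.comp (fun _ l => (k - l).toNat) fun _ => hm
  have h1 := hind.hasLaw_infinitePi hlaw (aemeasurable_pi_iff.2 fun a => (hlaw a).aemeasurable)
  have h2 : HasLaw (MeasurableEquiv.curry ℕ (Fin N × Fin N) ℕ)
      (Measure.infinitePi fun _ : ℕ => Measure.infinitePi fun _ : Fin N × Fin N => jumpLossLaw k μ)
      (Measure.infinitePi fun _ : ℕ × Fin N × Fin N => jumpLossLaw k μ) :=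
    ⟨(MeasurableEquiv.measurable _).aemeasurable,
      Measure.infinitePi_map_curry fun _ _ => jumpLossLaw k μ⟩
  have h3 : HasLaw (fun (c : ℕ → Fin N × Fin N → ℕ) t =>
        MeasurableEquiv.curry (Fin N) (Fin N) ℕ (c t))
      (lossLaw (Fin N) (jumpLossLaw k μ))
      (Measure.infinitePi fun _ : ℕ => Measure.infinitePi fun _ : Fin N × Fin N =>
        jumpLossLaw k μ) := by
    refine ⟨Measurable.aemeasurable (measurable_pi_lambda _ fun t =>
      (MeasurableEquiv.measurable _).comp (measurable_pi_apply t)), ?_⟩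
    rw [Measure.infinitePi_map_pi _ fun _ => MeasurableEquiv.measurable _,
      Measure.infinitePi_map_curry fun _ _ => jumpLossLaw k μ]
    simp only [lossLaw, lossMatrixLaw, Measure.infinitePi_eq_pi]
  exact h3.comp (h2.comp h1)

/-- The front has a deterministic speed `k - l`, where `l` is the rate of loss. -/
theorem IsIIDNoise.isFrontSpeed [Nonempty (Fin N)] (hξ : IsIIDNoise P ξ μ)
    (hmax : μ (Set.Ioi k) = 0) (hint : Integrable (fun l : ℤ => (l : ℝ)) μ) {l : ℝ}
    (hl : ∀ᵐ c ∂lossLaw (Fin N) (jumpLossLaw k μ),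
      Tendsto (fun t : ℕ => (minLoss c t : ℝ) / t) atTop (𝓝 l)) :
    IsFrontSpeed P ξ (k - l) := by
  have hlaw := hξ.hasLaw_loss k
  have h1 := hl.and (tendsto_sum_loss_div (ι := Fin N) (integrable_jumpLossLaw (k := k) hint))
  rw [← hlaw.map_eq] at h1
  have h2 := ae_of_ae_map hlaw.aemeasurable h1
  have h3 : ∀ᵐ ω ∂P, ∀ t i j, ξ t i j ω ≤ k := by
    simp only [ae_all_iff]
    intro t i j
    have hle : ∀ᵐ l ∂μ, l ≤ k := by
      rw [ae_iff]
      simpa [Set.Ioi] using hmax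
    rw [← (hξ.hasLaw t i j).map_eq] at hle
    exact ae_of_ae_map (hξ.hasLaw t i j).aemeasurable hle
  filter_upwards [h2, h3] with ω hω hk x₀
  refine tendsto_front_of_tendsto_minLoss (fun t i j => ?_) hω.1 hω.2 x₀
  have := hk t i j
  lia

end Transfer

/-! ### Speed and asymptotics -/

theorem theorem6p1
    (k : ℤ) (μ : Measure ℤ) [IsProbabilityMeasure μ]
    (hmax : μ (Set.Ioi k) = 0)
    (hR : 0 < μ.real {k} * μ.real {k - 1})
    (hint : Integrable (fun l : ℤ => (l : ℝ)) μ)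
    {Ω : ℕ → Type*} [∀ N, MeasurableSpace (Ω N)]
    (P : ∀ N, Measure (Ω N)) [∀ N, IsProbabilityMeasure (P N)]
    (ξ : ∀ N, ℕ → Fin N → Fin N → Ω N → ℤ)
    (hξ : ∀ N, 1 ≤ N → IsIIDNoise (P N) (ξ N) μ) :
    ∃ v : ℕ → ℝ,
      (∀ N, 1 ≤ N → IsFrontSpeed (P N) (ξ N) (v N)) ∧
      (fun N : ℕ => v N - ((k : ℝ) - (1 - μ.real {k}) ^ (N ^ 2) * 2 ^ N))
        =o[atTop] (fun N : ℕ => (1 - μ.real {k}) ^ (N ^ 2) * 2 ^ N) := by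
  have hp : 0 < μ.real {k} := pos_of_mul_pos_left hR measureReal_nonneg
  have hr : 0 < μ.real {k - 1} := pos_of_mul_pos_right hR measureReal_nonneg
  set κ := jumpLossLaw k μ with hκdef
  have hκ : Integrable (fun n : ℕ => (n : ℝ)) κ := integrable_jumpLossLaw hint
  have hq : κ.real {0}ᶜ = 1 - μ.real {k} := jumpLossLaw_real_compl_zero hmax
  have hs : κ.real {n | 2 ≤ n} < κ.real {0}ᶜ := jumpLossLaw_real_two_le_lt hr
  rw [← hq]
  set q := κ.real {0}ᶜ with hqdef
  have hq0 : 0 < q := lt_of_le_of_lt measureReal_nonneg hs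
  have hq1 : q < 1 := by linarith
  have hrate : ∀ N : ℕ, ∃ l : ℝ, 1 ≤ N →
      IsFrontSpeed (P N) (ξ N) (k - l) ∧ ∃ C : ℝ, ∀ n : ℕ, 1 ≤ n →
        ∫ c, (minLoss c n : ℝ) ∂lossLaw (Fin N) κ ≤ n * l ∧
        n * l ≤ ∫ c, (minLoss c n : ℝ) ∂lossLaw (Fin N) κ + C := by
    intro N
    by_cases hN : 1 ≤ N
    · have : Nonempty (Fin N) := ⟨⟨0, hN⟩⟩
      obtain ⟨l, C, h1, h2⟩ := exists_lossRate (ι := Fin N) hκ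
      exact ⟨l, fun _ => ⟨(hξ N hN).isFrontSpeed hmax hint h1, C, h2⟩⟩
    · exact ⟨0, fun h => absurd h hN⟩
  choose l hl using hrate
  refine ⟨fun N => k - l N, fun N hN => (hl N hN).1, ?_⟩
  rw [isLittleO_iff]
  intro δ hδ
  have t1 : Tendsto (fun N : ℕ => (N : ℝ) * q ^ N + (1 / 2) ^ N) atTop (𝓝 0) := by
    simpa using (tendsto_self_mul_const_pow_of_lt_one hq0.le hq1).add
      (tendsto_pow_atTop_nhds_zero_of_lt_one (r := (1 / 2 : ℝ)) (by norm_num) (by norm_num))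
  have t2 : Tendsto (fun N : ℕ => (N : ℝ) * (1 - q)) atTop atTop :=
    tendsto_natCast_atTop_atTop.atTop_mul_const (by linarith)
  filter_upwards [eventually_ge_atTop 1, t1.eventually_lt_const hδ, t2.eventually_ge_atTop 2,
    eventually_exists_supersolution (w := ∫ n, ((n - 1 : ℕ) : ℝ) ∂κ) hq0 hq1
      (measureReal_nonneg (μ := κ) (s := {n | 2 ≤ n})) hs hδ] with N hN hN1 hN2 hN3
  have : Nonempty (Fin N) := ⟨⟨0, hN⟩⟩
  obtain ⟨-, C, hC⟩ := hl N hN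
  obtain ⟨φ, η, hφ0, hφη, hφ⟩ := hN3
  set ε := q ^ (N ^ 2) * 2 ^ N with hε
  have hε0 : 0 < ε := by positivity
  have hup : l N ≤ (1 + δ) * ε :=
    lossRate_le hκ (fun n hn => (hC n hn).2) hφ0 hφη (by simpa using hφ)
  have hlow : ε * (1 - N * q ^ N - (1 / 2) ^ N) ≤ l N :=
    le_lossRate hκ (fun n hn => (hC n hn).1) (x := q ^ N) (by positivity)
      (pow_le_one₀ hq0.le hq1.le) (by
        simpa using fun z hz hzN => le_binomial_generating hq0 hq1 hz hzN hN2)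
  rw [Real.norm_eq_abs, Real.norm_of_nonneg hε0.le, abs_le]
  constructor <;> nlinarith
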